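/- Let $J=\begin{pmatrix}0&I\\-I&0\end{pmatrix}$ be the standard $6\times 6$ symplectic matrix, and let $A$ be a real $6\times6$ skew-Hamiltonian matrix, i.e. $A^{\rm T}J=JA$, which is generic in the sense that its characteristic polynomial is $\prod_{i=1}^3(\lambda-\lambda_i)^2$ with pairwise distinct (possibly complex) $\lambda_1,\lambda_2,\lambda_3$. Let $H$ be a homogeneous cubic polynomial on $\mathbb R^6$ with $A(\nabla^2H)=(\nabla^2H)A^{\rm T}$, and let $f=J\nabla H$, with Jacobi matrix $f'(x)$. Let $\varepsilon\in\mathbb R$. For a homogeneous quadratic vector field $v$ on $\mathbb R^6$, let $\Phi_v$ be its Kahan map with stepsize $2\varepsilon$, $$\Phi_v(x)=x+2\varepsilon\big(I-\varepsilon v'(x)\big)^{-1}v(x),\qquad x\in U_v=\{x\in\mathbb R^6:\det(I-\varepsilon v'(x))\neq0\}.$$ For $\{i,j,k\}=\{1,2,3\}$ and $b=\lambda_1\lambda_2+\lambda_2\lambda_3+\lambda_3\lambda_1$ put $$\alpha_i=\frac{\lambda_i^2-b}{(\lambda_i-\lambda_j)(\lambda_i-\lambda_k)},\quad \beta_i=\frac{2(\lambda_j+\lambda_k)}{(\lambda_i-\lambda_j)(\lambda_i-\lambda_k)},\quad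 \gamma_i=\frac{-2}{(\lambda_i-\lambda_j)(\lambda_i-\lambda_k)},\quad B_i=\alpha_iI+\beta_iA+\gamma_iA^2,$$ and let $$p_0=\tfrac18\operatorname{tr}\big((f')^2\big),\quad q_i=\tfrac18\operatorname{tr}\big(B_i^{\rm T}(f')^2\big),\quad p=p_0+\sum_{i=1}^3\alpha_iq_i,\quad q=\sum_{i=1}^3\beta_iq_i,\quad r=\sum_{i=1}^3\gamma_iq_i .$$ Then $p_0,q_i,p,q,r$ are quadratic forms in $x$ (or zero), $p,q,r$ have real coefficients, and the matrix $$\Pi(x)=J-\varepsilon^2(f'(x))^2J$$ satisfies $$\Pi=(1-\varepsilon^2p_0)J-\varepsilon^2\sum_{i=1}^3q_iB_i^{\rm T}J=(1-\varepsilon^2p)J-\varepsilon^2q\,A^{\rm T}J-\varepsilon^2r\,(A^{\rm T})^2J .$$ Moreover, $\Pi$ is a Poisson tensor on $\mathbb R^6$: it is skew-symmetric and the bracket $\{F,G\}=(\nabla F)^{\rm T}\,\Pi\,\nabla G$ satisfies the Jacobi identity on smooth functions. The map $\Phi_f$ is Poisson with respect to this bracket: $\{F\circ\Phi_f,G\circ\Phi_f\}=\{F,G\}\circ\Phi_f$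 on $U_f$ for all smooth $F,G$. Finally, if $g$ is associated to $f$, that is, $g=JB\nabla H$ with $B=\alpha I+\beta A+\gamma A^2$, $\alpha,\beta,\gamma\in\mathbb R$ and $B^2=I$, then $\Phi_g$ is Poisson on $U_g$ with respect to the same bracket. -/

import Mathlib

open Matrix
open scoped ContDiff

noncomputable section

namespace KahanPoisson

/-- Index set of the six coordinates of `ℝ⁶`, split into two blocks of three. -/
abbrev Idx := Fin 3 ⊕ Fin 3

/-- The phase space `ℝ⁶`. -/
abbrev Phase := Idx → ℝ

/-- The matrix `J = [[0, I], [-I, 0]]` over a commutative ring `R`. -/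
def symp (R : Type*) [CommRing R] : Matrix Idx Idx R :=
  Matrix.fromBlocks 0 1 (-1) 0

/-- `A` is skew-Hamiltonian: `Aᵀ J = J A`. -/
def IsSkewHamiltonian (A : Matrix Idx Idx ℝ) : Prop :=
  Aᵀ * symp ℝ = symp ℝ * A

/-- A constant matrix, seen as a matrix of (constant) polynomials. -/
def constMat {R : Type*} [CommRing R] (M : Matrix Idx Idx R) :
    Matrix Idx Idx (MvPolynomial Idx R) :=
  M.map MvPolynomial.C

/-- The gradient of a polynomial. -/
def gradient (H : MvPolynomial Idx ℝ) : Idx → MvPolynomial Idx ℝ :=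
  fun i => MvPolynomial.pderiv i H

/-- The Jacobi matrix `f'` of a polynomial vector field, `(f')ᵢⱼ = ∂fᵢ/∂xⱼ`. -/
def jacobian (f : Idx → MvPolynomial Idx ℝ) : Matrix Idx Idx (MvPolynomial Idx ℝ) :=
  Matrix.of fun i j => MvPolynomial.pderiv j (f i)

/-- The Hesse matrix of a polynomial. -/
def hessian (H : MvPolynomial Idx ℝ) : Matrix Idx Idx (MvPolynomial Idx ℝ) :=
  Matrix.of fun i j => MvPolynomial.pderiv i (MvPolynomial.pderiv j H)

/-- The system of second order equations `A (∇²H) = (∇²H) Aᵀ`. -/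
def SatisfiesPDE (A : Matrix Idx Idx ℝ) (H : MvPolynomial Idx ℝ) : Prop :=
  constMat A * hessian H = hessian H * (constMat A)ᵀ

/-- The Hamiltonian vector field `J ∇H`. -/
def hamField (H : MvPolynomial Idx ℝ) : Idx → MvPolynomial Idx ℝ :=
  symp (MvPolynomial Idx ℝ) *ᵥ gradient H

/-- `g` is associated to `J ∇H` (with respect to `A`): there is `B = α I + β A + γ A²` with
`B² = I` and `g = J B ∇H`. -/
def IsAssociated (A : Matrix Idx Idx ℝ) (H : MvPolynomial Idx ℝ)
    (g : Idx → MvPolynomial Idx ℝ) : Prop :=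
  ∃ α β γ : ℝ, ∃ B : Matrix Idx Idx ℝ,
    B = α • (1 : Matrix Idx Idx ℝ) + β • A + γ • A ^ 2 ∧ B ^ 2 = 1 ∧
    g = (symp (MvPolynomial Idx ℝ) * constMat B) *ᵥ gradient H

/-! ### The Kahan map -/

/-- The value of a polynomial vector field at a point. -/
def evalField (f : Idx → MvPolynomial Idx ℝ) (x : Phase) : Phase :=
  fun i => MvPolynomial.eval x (f i)

/-- The value of a matrix of polynomials at a point. -/
def evalMat (M : Matrix Idx Idx (MvPolynomial Idx ℝ)) (x : Phase) : Matrix Idx Idx ℝ :=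
  M.map (MvPolynomial.eval x)

/-- The Kahan discretization (stepsize `2ε`) of a homogeneous quadratic vector field:
`y - x = 2ε Q(x, y)`, where `Q(x, y) = (f(x + y) - f(x) - f(y)) / 2` is the symmetric bilinear
form of `f`. -/
def IsKahanStep (f : Idx → MvPolynomial Idx ℝ) (ε : ℝ) (x y : Phase) : Prop :=
  y - x = (2 * ε) • ((1 / 2 : ℝ) • (evalField f (x + y) - evalField f x - evalField f y))

/-- The set where the linear system defining the Kahan map is non-degenerate. -/
def kahanDomain (f : Idx → MvPolynomial Idx ℝ) (ε : ℝ) : Set Phase :=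
  {x | (1 - ε • evalMat (jacobian f) x).det ≠ 0}

/-- The Kahan map `Φ_f(x, ε) = x + 2ε (I - ε f'(x))⁻¹ f(x)`; it is meaningful on
`kahanDomain f ε`, where it is the unique solution of the Kahan equation, see
`isKahanStep_iff`. -/
def kahanMap (f : Idx → MvPolynomial Idx ℝ) (ε : ℝ) (x : Phase) : Phase :=
  x + (2 * ε) • ((1 - ε • evalMat (jacobian f) x)⁻¹ *ᵥ evalField f x)

theorem polarization (q : MvPolynomial Idx ℝ) (hq : q.IsHomogeneous 2) (x y : Phase) :
    MvPolynomial.eval (x + y) q - MvPolynomial.eval x q - MvPolynomial.eval y q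
      = ∑ j, MvPolynomial.eval x (MvPolynomial.pderiv j q) * y j := by
  have hq' : q ∈ (MvPolynomial.homogeneousSubmodule Idx ℝ 1) ^ 2 := by
    rw [MvPolynomial.homogeneousSubmodule_one_pow]; exact hq
  rw [pow_two, MvPolynomial.homogeneousSubmodule_one_eq_span_X, Submodule.span_mul_span] at hq'
  clear hq
  induction hq' using Submodule.span_induction with
  | mem q h =>
    obtain ⟨_, ⟨a, rfl⟩, _, ⟨b, rfl⟩, rfl⟩ := h
    have h : ∀ j, MvPolynomial.eval x (MvPolynomial.pderiv j
        ((MvPolynomial.X a : MvPolynomial Idx ℝ) * MvPolynomial.X b)) * y j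
        = (if j = a then y j * x b else 0) + (if j = b then x a * y j else 0) := by
      intro j
      rw [Derivation.leibniz, MvPolynomial.pderiv_X, MvPolynomial.pderiv_X]
      by_cases h1 : j = a <;> by_cases h2 : j = b <;>
        simp [Pi.single_apply, h1, h2, eq_comm] <;> split_ifs <;> simp_all <;> ring
    simp only [h, Finset.sum_add_distrib, Finset.sum_ite_eq', Finset.mem_univ, if_true,
      map_mul, MvPolynomial.eval_X, Pi.add_apply]
    ring
  | zero => simp
  | add u v _ _ hu hv =>
    simp only [map_add, add_mul, Finset.sum_add_distrib] at *
    linarith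
  | smul c u _ hu =>
    simp only [MvPolynomial.smul_eval, Derivation.map_smul, mul_assoc, ← Finset.mul_sum] at *
    linear_combination c * hu

/-- Where the linear system is non-degenerate, the Kahan map is the solution of the Kahan
equation. -/
theorem isKahanStep_iff (f : Idx → MvPolynomial Idx ℝ) (hf : ∀ i, (f i).IsHomogeneous 2)
    (ε : ℝ) (x : Phase) (hx : x ∈ kahanDomain f ε) (y : Phase) :
    IsKahanStep f ε x y ↔ y = kahanMap f ε x := by
  have hpol : ∀ y, evalField f (x + y) - evalField f x - evalField f y
      = evalMat (jacobian f) x *ᵥ y := fun y => funext fun i => polarization (f i) (hf i) x y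
  have hx2 : evalMat (jacobian f) x *ᵥ x = (2 : ℝ) • evalField f x := by
    funext i
    have h := congrArg (MvPolynomial.eval x) (hf i).sum_X_mul_pderiv
    simp only [map_sum, map_mul, MvPolynomial.eval_X, nsmul_eq_mul, map_natCast] at h
    simp only [mulVec, dotProduct, evalMat, jacobian, evalField, Matrix.map_apply, of_apply,
      Pi.smul_apply, smul_eq_mul, mul_comm (MvPolynomial.eval x _) (x _)]
    exact_mod_cast h
  have hu : IsUnit (1 - ε • evalMat (jacobian f) x).det := isUnit_iff_ne_zero.2 hx
  unfold IsKahanStep kahanMap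
  rw [hpol]
  set M := evalMat (jacobian f) x
  set N := 1 - ε • M with hN
  have e1 : (2 * ε) • ((1 / 2 : ℝ) • (M *ᵥ y)) = ε • (M *ᵥ y) := by
    rw [smul_smul]; congr 1; ring
  have e2 : x + (2 * ε) • (N⁻¹ *ᵥ evalField f x) = N⁻¹ *ᵥ x := by
    have : N *ᵥ x + (2 * ε) • evalField f x = x := by
      rw [hN, sub_mulVec, smul_mulVec, hx2, smul_smul, one_mulVec, mul_comm ε 2]; abel
    conv_rhs => rw [← this]
    rw [mulVec_add, mulVec_mulVec, nonsing_inv_mul _ hu, one_mulVec, mulVec_smul]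
  rw [e1, e2]
  have e3 : y - x = ε • (M *ᵥ y) ↔ N *ᵥ y = x := by
    rw [hN, sub_mulVec, smul_mulVec, one_mulVec, sub_eq_iff_eq_add, sub_eq_iff_eq_add, add_comm]
  rw [e3]
  constructor
  · intro h
    rw [← h, mulVec_mulVec, nonsing_inv_mul _ hu, one_mulVec]
  · intro h
    rw [h, mulVec_mulVec, mul_nonsing_inv _ hu, one_mulVec]

/-! ### Poisson tensors and Poisson maps on `ℝ⁶` -/

/-- The partial derivative `∂F/∂xᵢ` at `x`. -/
def partialD (F : Phase → ℝ) (x : Phase) (i : Idx) : ℝ :=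
  fderiv ℝ F x (Pi.single i 1)

/-- The bracket `{F, G}(x) = ∇F(x)ᵀ P(x) ∇G(x)` defined by a field of matrices `P`. -/
def bracket (P : Phase → Matrix Idx Idx ℝ) (F G : Phase → ℝ) (x : Phase) : ℝ :=
  partialD F x ⬝ᵥ (P x *ᵥ partialD G x)

/-- `P` is a Poisson tensor: a smooth field of skew-symmetric matrices whose bracket satisfies the
Jacobi identity on smooth functions. -/
structure IsPoissonTensor (P : Phase → Matrix Idx Idx ℝ) : Prop where
  smooth : ∀ i j, ContDiff ℝ ∞ fun x => P x i j
  skew : ∀ x, (P x)ᵀ = -P x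
  jacobi : ∀ F G K : Phase → ℝ, ContDiff ℝ ∞ F → ContDiff ℝ ∞ G → ContDiff ℝ ∞ K → ∀ x,
    bracket P F (bracket P G K) x + bracket P G (bracket P K F) x
      + bracket P K (bracket P F G) x = 0

/-- The map `Φ`, defined on the open set `U`, is smooth and Poisson for the bracket of `P`:
`{F ∘ Φ, G ∘ Φ} = {F, G} ∘ Φ` on `U` for all smooth `F`, `G`. -/
structure IsPoissonMapOn (P : Phase → Matrix Idx Idx ℝ) (Φ : Phase → Phase) (U : Set Phase) :
    Prop where
  isOpen : IsOpen U
  smooth : ContDiffOn ℝ ∞ Φ U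
  bracket_comp : ∀ F G : Phase → ℝ, ContDiff ℝ ∞ F → ContDiff ℝ ∞ G → ∀ x ∈ U,
    bracket P (F ∘ Φ) (G ∘ Φ) x = bracket P F G (Φ x)

/-- The matrix `Π = J - ε² (f')² J` of polynomials. -/
def tensor (f : Idx → MvPolynomial Idx ℝ) (ε : ℝ) : Matrix Idx Idx (MvPolynomial Idx ℝ) :=
  symp _ - ε ^ 2 • (jacobian f ^ 2 * symp _)

/-! ### The coefficient polynomials

The eigenvalues `ev 0, ev 1, ev 2` of `A` may be complex, so the matrices `Bᵢ` and the polynomials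
`qᵢ` have complex coefficients. For `i : Fin 3` the other two indices are `i + 1` and `i + 2`. -/

/-- `(λᵢ - λⱼ)(λᵢ - λₖ)` with `{i, j, k} = {0, 1, 2}`. -/
def den (ev : Fin 3 → ℂ) (i : Fin 3) : ℂ :=
  (ev i - ev (i + 1)) * (ev i - ev (i + 2))

/-- `αᵢ = (λᵢ² - b) / ((λᵢ - λⱼ)(λᵢ - λₖ))` with `b = λ₁λ₂ + λ₂λ₃ + λ₃λ₁`. -/
def alphaC (ev : Fin 3 → ℂ) (i : Fin 3) : ℂ :=
  (ev i ^ 2 - (ev 0 * ev 1 + ev 1 * ev 2 + ev 2 * ev 0)) / den ev i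

/-- `βᵢ = 2 (λⱼ + λₖ) / ((λᵢ - λⱼ)(λᵢ - λₖ))`. -/
def betaC (ev : Fin 3 → ℂ) (i : Fin 3) : ℂ :=
  2 * (ev (i + 1) + ev (i + 2)) / den ev i

/-- `γᵢ = -2 / ((λᵢ - λⱼ)(λᵢ - λₖ))`. -/
def gammaC (ev : Fin 3 → ℂ) (i : Fin 3) : ℂ :=
  -2 / den ev i

/-- `αᵢ + βᵢ t + γᵢ t²` is the quadratic polynomial with value `-1` at `λᵢ` and `1` at the other
two eigenvalues. -/
theorem interpolation (ev : Fin 3 → ℂ) (hev : Function.Injective ev) (i j : Fin 3) :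
    alphaC ev i + betaC ev i * ev j + gammaC ev i * ev j ^ 2 = if j = i then -1 else 1 := by
  have h01 : ev 0 - ev 1 ≠ 0 := sub_ne_zero.2 fun h => absurd (hev h) (by decide)
  have h12 : ev 1 - ev 2 ≠ 0 := sub_ne_zero.2 fun h => absurd (hev h) (by decide)
  have h20 : ev 2 - ev 0 ≠ 0 := sub_ne_zero.2 fun h => absurd (hev h) (by decide)
  have h10 : ev 1 - ev 0 ≠ 0 := sub_ne_zero.2 fun h => absurd (hev h) (by decide)
  have h21 : ev 2 - ev 1 ≠ 0 := sub_ne_zero.2 fun h => absurd (hev h) (by decide)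
  have h02 : ev 0 - ev 2 ≠ 0 := sub_ne_zero.2 fun h => absurd (hev h) (by decide)
  fin_cases i <;> fin_cases j <;> simp [alphaC, betaC, gammaC, den] <;> field_simp <;> ring

/-- The complexification of a real matrix. -/
def toC (A : Matrix Idx Idx ℝ) : Matrix Idx Idx ℂ :=
  A.map (algebraMap ℝ ℂ)

/-- The complexification of a real matrix of polynomials. -/
def toCPoly (M : Matrix Idx Idx (MvPolynomial Idx ℝ)) : Matrix Idx Idx (MvPolynomial Idx ℂ) :=
  M.map (MvPolynomial.map (algebraMap ℝ ℂ))

/-- `Bᵢ = αᵢ I + βᵢ A + γᵢ A²`. -/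
def matB (A : Matrix Idx Idx ℝ) (ev : Fin 3 → ℂ) (i : Fin 3) : Matrix Idx Idx ℂ :=
  alphaC ev i • (1 : Matrix Idx Idx ℂ) + betaC ev i • toC A + gammaC ev i • toC A ^ 2

/-- `p₀ = tr((f')²) / 8`. -/
def pZero (f : Idx → MvPolynomial Idx ℝ) : MvPolynomial Idx ℂ :=
  (1 / 8 : ℂ) • (toCPoly (jacobian f) ^ 2).trace

/-- `qᵢ = tr(Bᵢᵀ (f')²) / 8`. -/
def qPoly (A : Matrix Idx Idx ℝ) (ev : Fin 3 → ℂ) (f : Idx → MvPolynomial Idx ℝ) (i : Fin 3) :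
    MvPolynomial Idx ℂ :=
  (1 / 8 : ℂ) • ((constMat (matB A ev i))ᵀ * toCPoly (jacobian f) ^ 2).trace

end KahanPoisson

end

noncomputable section

namespace KahanPoisson

/-! Write `M(x) = f'(x) = J ∇²H(x)`. It is a Hamiltonian matrix, `Mᵀ J = -J M`, and the equations
for `H` say exactly that it commutes with `Aᵀ`. For an eigenvalue `μ` of `A` the matrix `J (A - μ)`
is skew-symmetric, singular and of even size, so its kernel is at least a plane
(`two_le_finrank_ker_of_transpose_eq_neg`). Three distinct eigenvalues therefore fill the six
dimensions, and `A` is diagonalizable (`exists_eigenbasis`).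

The rank-two spectral projectors `Eᵢ` of `Aᵀ` commute with `M`, and `M` induces on each range a
traceless 2 × 2 matrix, whose square is scalar by Cayley-Hamilton (`two_smul_projector_mul_sq`).
Hence `M² = ½ ∑ tᵢ Eᵢ` with `tᵢ = tr(Eᵢ M²)`. As `Bᵢᵀ = 1 - 2 Eᵢ`, this is `p₀ + ∑ qᵢ Bᵢᵀ`
(`jacobian_sq_eq`), a polynomial in `Aᵀ` whose coefficients are real because `I, A, A²` are linearly
independent.

Consequently `M(x)²` commutes with every `M(y)`. Together with the Hamiltonian property and the
symmetry `M(x) y = M(y) x`, this suffices for the Poisson statements. The Jacobi identity becomes a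
pairwise cancellation (`isPoissonTensor_tensor`), and the derivative `(1 - ε M(x))⁻¹ (1 + ε
M(Φ(x)))` of the Kahan map carries `Π(x)` to `Π(Φ(x))` by rearranging commuting factors
(`kahan_matrix_identity`). An associated field has Jacobi matrix `Bᵀ M`, whose square is again `M²`
since `B² = 1`; it has the same tensor and the same argument applies. -/

/-! ### Kernels of skew-symmetric matrices -/

theorem det_eq_zero_of_transpose_eq_neg {K n : Type*} [Field K] [CharZero K] [Fintype n]
    [DecidableEq n] (X : Matrix n n K) (hX : Xᵀ = -X)
    (hn : Odd (Fintype.card n)) : X.det = 0 := by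
  have h : X.det = -X.det := by
    conv_lhs => rw [← det_transpose, hX, det_neg, hn.neg_one_pow, neg_one_mul]
  exact self_eq_neg.1 h

theorem dotProduct_mulVec_skew {R n : Type*} [CommRing R] [Fintype n] (X : Matrix n n R)
    (hX : Xᵀ = -X) (u v : n → R) :
    u ⬝ᵥ (X *ᵥ v) = -((X *ᵥ u) ⬝ᵥ v) := by
  rw [dotProduct_mulVec, ← mulVec_transpose, hX, neg_mulVec, neg_dotProduct]

/-- The kernel of a singular skew-symmetric matrix of even size is at least two-dimensional. -/
theorem two_le_finrank_ker_of_transpose_eq_neg {K n : Type*} [Field K] [CharZero K] [Fintype n]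
    [DecidableEq n] (X : Matrix n n K) (hX : Xᵀ = -X)
    (hn : Even (Fintype.card n)) (hdet : X.det = 0) :
    2 ≤ Module.finrank K (LinearMap.ker X.mulVecLin) := by
  set W := LinearMap.ker X.mulVecLin with hW
  have hmem : ∀ v, v ∈ W ↔ X *ᵥ v = 0 := fun v => by simp [hW]
  by_contra! hlt
  obtain ⟨v, hv0, hv⟩ := exists_mulVec_eq_zero_iff.2 hdet
  have hpos : 0 < Module.finrank K W :=
    Module.finrank_pos_iff_exists_ne_zero.2 ⟨⟨v, (hmem v).2 hv⟩, fun h => hv0 (congrArg Subtype.val h)⟩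
  -- If the kernel `W` were a line, `C` would have odd dimension and the skew form would degenerate
  -- on it. A vector `u` of `C` orthogonal to `C` is also orthogonal to `W`, hence lies in `W ∩ C =
  -- 0`.
  obtain ⟨C, hC⟩ := W.exists_isCompl
  have hsum := Submodule.finrank_add_eq_of_isCompl hC
  rw [Module.finrank_fintype_fun_eq_card] at hsum
  have hodd : Odd (Module.finrank K C) := by
    rw [← hsum] at hn
    have h1 : Module.finrank K W = 1 := by omega
    rw [h1] at hn
    rcases Nat.even_or_odd (Module.finrank K C) with h | h
    · exact absurd hn (by rw [Nat.not_even_iff_odd, add_comm]; exact h.add_one)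
    · exact h
  let b := Module.finBasis K C
  let Y : Matrix (Fin (Module.finrank K C)) (Fin (Module.finrank K C)) K :=
    Matrix.of fun i j => (b i : n → K) ⬝ᵥ (X *ᵥ (b j : n → K))
  have hY : Yᵀ = -Y := by
    ext i j
    change (b j : n → K) ⬝ᵥ (X *ᵥ (b i : n → K)) = -((b i : n → K) ⬝ᵥ (X *ᵥ (b j : n → K)))
    rw [dotProduct_mulVec_skew X hX, dotProduct_comm]
  obtain ⟨c, hc0, hc⟩ := exists_mulVec_eq_zero_iff.2
    (det_eq_zero_of_transpose_eq_neg Y hY (by simpa using hodd))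
  set u : C := ∑ j, c j • b j with hu
  have hu0 : u ≠ 0 := fun h => hc0 (funext fun j =>
    Fintype.linearIndependent_iff.1 b.linearIndependent c (by rw [← hu, h]) j)
  have hbu : ∀ i, (b i : n → K) ⬝ᵥ (X *ᵥ (u : n → K)) = 0 := by
    intro i
    have := congrFun hc i
    simp only [mulVec, dotProduct, Y, of_apply, Pi.zero_apply] at this
    rw [← this]
    have hu' : (u : n → K) = ∑ j, c j • (b j : n → K) := by simp [hu]
    rw [hu', ← mulVecLin_apply, map_sum, dotProduct_sum]
    refine Finset.sum_congr rfl fun j _ => ?_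
    rw [map_smul, dotProduct_smul, mulVecLin_apply, smul_eq_mul, mul_comm]
    rfl
  have hCu : ∀ w ∈ C, w ⬝ᵥ (X *ᵥ (u : n → K)) = 0 := by
    intro w hw
    have hw' : w = ((∑ j, b.repr ⟨w, hw⟩ j • b j : C) : n → K) := by rw [b.sum_repr]
    rw [hw']
    simp only [Submodule.coe_sum, Submodule.coe_smul, sum_dotProduct, smul_dotProduct, hbu,
      smul_zero, Finset.sum_const_zero]
  have hXu : X *ᵥ (u : n → K) = 0 := by
    refine dotProduct_eq_zero _ fun w => ?_
    have hw : w ∈ W ⊔ C := by rw [hC.sup_eq_top]; trivial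
    obtain ⟨y, hy, z, hz, rfl⟩ := Submodule.mem_sup.1 hw
    rw [dotProduct_comm, add_dotProduct, hCu z hz, dotProduct_mulVec_skew X hX, (hmem y).1 hy]
    simp
  have := (Submodule.disjoint_def.1 hC.disjoint) u ((hmem _).2 hXu) u.2
  exact hu0 (Subtype.ext this)

/-! ### Eigenspaces of skew-Hamiltonian matrices -/

theorem symp_mul_symp (R : Type*) [CommRing R] : symp R * symp R = -1 := by
  simp [symp, fromBlocks_multiply, ← fromBlocks_one, fromBlocks_neg]

theorem symp_transpose (R : Type*) [CommRing R] : (symp R)ᵀ = -symp R := by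
  simp [symp, fromBlocks_transpose, fromBlocks_neg]

theorem symp_map {R S : Type*} [CommRing R] [CommRing S] (φ : R →+* S) :
    (symp R).map φ = symp S := by
  have h : (-1 : Matrix (Fin 3) (Fin 3) R).map φ = -1 := by
    ext i j
    simp [one_apply, apply_ite φ]
  simp [symp, fromBlocks_map, h]

/-- The eigenspaces of a complex skew-Hamiltonian matrix are at least two-dimensional: they contain
the columns of a `6 × 2` matrix of full rank. -/
theorem exists_eigenvector_pair (A : Matrix Idx Idx ℂ) (hA : Aᵀ * symp ℂ = symp ℂ * A) (μ : ℂ)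
    (hμ : A.charpoly.eval μ = 0) :
    ∃ U : Matrix Idx (Fin 2) ℂ, A * U = μ • U ∧ Function.Injective U.mulVec := by
  -- `J A` is skew-symmetric because `A` is skew-Hamiltonian, so `X` is too; `J` being invertible,
  -- its kernel is the eigenspace.
  set X := symp ℂ * (A - μ • 1) with hXdef
  have hX : Xᵀ = -X := by
    rw [hXdef, transpose_mul, symp_transpose, transpose_sub, transpose_smul, transpose_one,
      mul_neg, sub_mul, hA, mul_sub]
    simp
  have hdet : X.det = 0 := by
    rw [hXdef, det_mul]
    rw [eval_charpoly] at hμ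
    have : A - μ • 1 = -(scalar Idx μ - A) := by
      rw [neg_sub, smul_one_eq_diagonal]; rfl
    rw [this, det_neg, hμ]; simp
  have h2 := two_le_finrank_ker_of_transpose_eq_neg X hX (by simp; decide) hdet
  obtain ⟨w, hw⟩ := exists_linearIndependent_of_le_finrank h2
  have hXw : ∀ v, X *ᵥ v = 0 → A *ᵥ v = μ • v := by
    intro v hv
    have : symp ℂ *ᵥ (X *ᵥ v) = 0 := by rw [hv, mulVec_zero]
    rw [hXdef, mulVec_mulVec, ← mul_assoc, symp_mul_symp, neg_one_mul, neg_mulVec, neg_eq_zero,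
      sub_mulVec, smul_mulVec, one_mulVec, sub_eq_zero] at this
    exact this
  refine ⟨Matrix.of fun i j => (w j : Idx → ℂ) i, ?_, ?_⟩
  · ext i j
    have := congrFun (hXw (w j) (LinearMap.mem_ker.1 (w j).2)) i
    simpa [mul_apply, mulVec, dotProduct] using this
  · rw [mulVec_injective_iff]
    exact hw.map' (Submodule.subtype _) (Submodule.ker_subtype _)

/-- A polynomial in `A` acts on an eigenvector by its value at the eigenvalue, which `interpolation`
supplies. -/
theorem matB_mul_eigenvectors (A : Matrix Idx Idx ℝ) (ev : Fin 3 → ℂ) (hev : Function.Injective ev)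
    {m : Type*} (U : Matrix Idx m ℂ) (j : Fin 3) (hU : toC A * U = ev j • U) (i : Fin 3) :
    matB A ev i * U = (if j = i then (-1 : ℂ) else 1) • U := by
  have h2 : toC A ^ 2 * U = (ev j ^ 2) • U := by
    rw [pow_two, Matrix.mul_assoc, hU, Matrix.mul_smul, hU, smul_smul, pow_two]
  rw [matB, Matrix.add_mul, Matrix.add_mul, smul_mul, smul_mul, smul_mul, h2, hU, Matrix.one_mul,
    smul_smul, smul_smul, ← add_smul, ← add_smul, interpolation ev hev]

/-- A generic skew-Hamiltonian matrix is diagonalizable: there are a full set of eigenvectors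
(the columns of the `U i`) and a dual set (the rows of the `V i`). -/
theorem exists_eigenbasis (A : Matrix Idx Idx ℝ) (hA : IsSkewHamiltonian A)
    (ev : Fin 3 → ℂ) (hev : Function.Injective ev)
    (hchar : (toC A).charpoly = ∏ i, (Polynomial.X - Polynomial.C (ev i)) ^ 2) :
    ∃ (U : Fin 3 → Matrix Idx (Fin 2) ℂ) (V : Fin 3 → Matrix (Fin 2) Idx ℂ),
      (∀ i, toC A * U i = ev i • U i) ∧ (∀ i, V i * U i = 1) ∧ ∑ i, U i * V i = 1 := by
  have hA' : (toC A)ᵀ * symp ℂ = symp ℂ * toC A := by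
    have := congrArg (fun M : Matrix Idx Idx ℝ => M.map (algebraMap ℝ ℂ)) hA
    rw [Matrix.map_mul, Matrix.map_mul, symp_map, transpose_map] at this
    exact this
  have hroot : ∀ i, (toC A).charpoly.eval (ev i) = 0 := by
    intro i
    rw [hchar, Polynomial.eval_prod]
    exact Finset.prod_eq_zero (Finset.mem_univ i) (by simp)
  choose U hU hinj using fun i => exists_eigenvector_pair (toC A) hA' (ev i) (hroot i)
  let S : Matrix Idx (Fin 3 × Fin 2) ℂ := Matrix.of fun a p => U p.1 a p.2
  have hS : ∀ c, S *ᵥ c = ∑ i, U i *ᵥ fun j => c (i, j) := by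
    intro c
    ext a
    simp [S, mulVec, dotProduct, Fintype.sum_prod_type]
  have hSinj : Function.Injective S.mulVec := by
    refine (injective_iff_map_eq_zero S.mulVecLin).2 fun c hc => ?_
    rw [mulVecLin_apply, hS] at hc
    -- `B_k` changes the sign of the `k`-th summand of a vanishing sum and fixes the others, so
    -- twice that summand is zero.
    have key : ∀ k, U k *ᵥ (fun j => c (k, j)) = 0 := by
      intro k
      have h1 : ∑ i, matB A ev k *ᵥ (U i *ᵥ fun j => c (i, j)) = 0 := by
        rw [← mulVec_sum, hc, mulVec_zero]
      have h2 : ∀ i, matB A ev k *ᵥ (U i *ᵥ fun j => c (i, j))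
          = (U i *ᵥ fun j => c (i, j)) - if i = k then (2 : ℂ) • (U k *ᵥ fun j => c (k, j)) else 0 := by
        intro i
        rw [mulVec_mulVec, matB_mul_eigenvectors A ev hev (U i) i (hU i), smul_mulVec]
        split_ifs with h
        · subst h; module
        · simp
      simp only [h2, Finset.sum_sub_distrib, hc, Finset.sum_ite_eq', Finset.mem_univ, if_true,
        zero_sub, neg_eq_zero, smul_eq_zero, two_ne_zero, false_or] at h1
      exact h1
    ext ⟨k, j⟩
    exact congrFun (hinj k ((key k).trans (mulVec_zero _).symm)) j
  obtain ⟨g, hg⟩ := LinearMap.exists_leftInverse_of_injective S.mulVecLin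
    (LinearMap.ker_eq_bot.2 hSinj)
  obtain ⟨T, rfl⟩ : ∃ T : Matrix (Fin 3 × Fin 2) Idx ℂ, T.mulVecLin = g :=
    ⟨LinearMap.toMatrix' g, Matrix.toLin'_toMatrix' g⟩
  have hT : T * S = 1 := by
    rw [← mulVecLin_mul, ← mulVecLin_one] at hg
    exact Matrix.toLin'.injective hg
  -- Since 3 · 2 = 6, a left inverse of `S` is two-sided. This gives the resolution of the identity.
  have hT' : S * T = 1 := (mul_eq_one_comm_of_card_eq _ _ _ (by simp)).1 hT
  refine ⟨U, fun i => Matrix.of fun j a => T (i, j) a, hU, fun i => ?_, ?_⟩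
  · ext j j'
    have := congrFun (congrFun hT (i, j)) (i, j')
    simpa [mul_apply, S, one_apply] using this
  · rw [← hT']
    ext a a'
    simp [mul_apply, S, Fintype.sum_prod_type, Matrix.sum_apply]

/-! ### The square of a Hamiltonian matrix commuting with a rank-two projector -/

/-- Cayley-Hamilton: a traceless `m` has `m² = -det m`, whose trace is `-2 det m`. The factor 2
stays on the left because `R` need not contain 1/2. -/
theorem two_smul_mul_self_of_trace_eq_zero {R : Type*} [CommRing R] (m : Matrix (Fin 2) (Fin 2) R)
    (hm : m.trace = 0) : (2 : R) • (m * m) = (m * m).trace • (1 : Matrix (Fin 2) (Fin 2) R) := by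
  rw [trace_fin_two] at hm
  ext i j
  fin_cases i <;> fin_cases j <;>
    simp [mul_apply, Fin.sum_univ_two, trace_fin_two] <;> grind

/-- The 2 × 2 matrix `m = v M u` represents `M` on the range of the projector `u v`. Compatibility
with `J` makes it traceless, so `m²` is scalar; sandwiching between `u` and `v` returns to size six.
-/
theorem two_smul_projector_mul_sq {R : Type*} [CommRing R] [IsDomain R] [CharZero R]
    (M : Matrix Idx Idx R) (hM : Mᵀ * symp R = -(symp R * M))
    (u : Matrix Idx (Fin 2) R) (v : Matrix (Fin 2) Idx R) (huv : v * u = 1)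
    (hcomm : u * v * M = M * (u * v)) (hE : u * v * symp R = symp R * (u * v)ᵀ) :
    (2 : R) • (u * v * M ^ 2) = (u * v * M ^ 2).trace • (u * v) := by
  set E := u * v with hEdef
  clear_value E
  have hEE : E * E = E := by
    rw [hEdef, Matrix.mul_assoc, ← Matrix.mul_assoc v, huv, Matrix.one_mul]
  have hMT : Mᵀ = symp R * M * symp R := by
    have := congrArg (· * symp R) hM
    simp only [Matrix.mul_assoc, symp_mul_symp, mul_neg, Matrix.mul_one, neg_mul] at this
    rw [Matrix.mul_assoc]
    exact neg_injective this
  -- Transposing inside the trace and substituting `Mᵀ = J M J` turns the trace into its own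
  -- negative.
  have htr : (M * E).trace = 0 := by
    have h1 : (M * E).trace = -(M * E).trace := by
      calc (M * E).trace = (Eᵀ * (symp R * M * symp R)).trace := by
            rw [← trace_transpose, transpose_mul, hMT]
        _ = (symp R * M * (E * symp R)).trace := by rw [trace_mul_comm, Matrix.mul_assoc, ← hE]
        _ = (E * (symp R * symp R) * M).trace := by
            rw [trace_mul_comm]; simp only [Matrix.mul_assoc]
        _ = -(M * E).trace := by rw [symp_mul_symp]; simp [hcomm]
    exact self_eq_neg.1 h1
  set m := v * M * u with hm
  clear_value m
  have hmtr : m.trace = 0 := by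
    rw [hm, Matrix.mul_assoc, trace_mul_comm, Matrix.mul_assoc, ← hEdef]; exact htr
  have humv : u * (m * m) * v = E * M ^ 2 := by
    have : u * (m * m) * v = E * M * E * (M * E) := by
      simp only [hm, hEdef, Matrix.mul_assoc]
    have hEME : E * M * E = E * M := by rw [hcomm, Matrix.mul_assoc, hEE]
    rw [this, hEME, ← hcomm, ← Matrix.mul_assoc, hEME, Matrix.mul_assoc, pow_two]
  have htr2 : (m * m).trace = (E * M ^ 2).trace := by
    rw [← humv, trace_mul_comm (u * (m * m)) v, ← Matrix.mul_assoc v u, huv, Matrix.one_mul]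
  have := congrArg (fun X => u * X * v) (two_smul_mul_self_of_trace_eq_zero m hmtr)
  simpa only [Matrix.mul_smul, Matrix.smul_mul, humv, htr2, Matrix.mul_one, ← hEdef] using this

/-! ### The Jacobi matrix of a Hamiltonian vector field -/

/-- The commutator of two derivations is a derivation, and this one kills the variables. -/
theorem pderiv_pderiv_comm {σ R : Type*} [CommRing R] (i j : σ) (p : MvPolynomial σ R) :
    MvPolynomial.pderiv i (MvPolynomial.pderiv j p)
      = MvPolynomial.pderiv j (MvPolynomial.pderiv i p) := by
  classical
  have h : ⁅(MvPolynomial.pderiv i : Derivation R (MvPolynomial σ R) _),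
      (MvPolynomial.pderiv j : Derivation R (MvPolynomial σ R) _)⁆ = 0 := by
    refine MvPolynomial.derivation_ext fun k => ?_
    rw [Derivation.commutator_apply, MvPolynomial.pderiv_X, MvPolynomial.pderiv_X]
    simp [Pi.single_apply, apply_ite]
  have := DFunLike.congr_fun h p
  rwa [Derivation.commutator_apply, Derivation.zero_apply, sub_eq_zero] at this

theorem hessian_transpose (H : MvPolynomial Idx ℝ) : (hessian H)ᵀ = hessian H := by
  ext1 i j
  exact pderiv_pderiv_comm j i H

theorem constMat_mul {R : Type*} [CommRing R] (M N : Matrix Idx Idx R) :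
    constMat (M * N) = constMat M * constMat N :=
  Matrix.map_mul

theorem constMat_transpose {R : Type*} [CommRing R] (M : Matrix Idx Idx R) :
    constMat Mᵀ = (constMat M)ᵀ :=
  rfl

theorem constMat_symp (R : Type*) [CommRing R] : constMat (symp R) = symp (MvPolynomial Idx R) :=
  symp_map _

theorem constMat_one {R : Type*} [CommRing R] : constMat (1 : Matrix Idx Idx R) = 1 :=
  map_one (RingHom.mapMatrix (MvPolynomial.C : R →+* MvPolynomial Idx R))

theorem jacobian_constMat_mulVec (M : Matrix Idx Idx ℝ) (H : MvPolynomial Idx ℝ) :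
    jacobian (constMat M *ᵥ gradient H) = constMat M * hessian H := by
  ext1 i j
  simp only [jacobian, of_apply, mulVec, dotProduct, map_sum, Matrix.mul_apply, hessian, gradient]
  refine Finset.sum_congr rfl fun k _ => ?_
  rw [constMat, map_apply, ← MvPolynomial.smul_eq_C_mul, Derivation.map_smul,
    MvPolynomial.smul_eq_C_mul, pderiv_pderiv_comm]

theorem jacobian_hamField (H : MvPolynomial Idx ℝ) :
    jacobian (hamField H) = symp _ * hessian H := by
  rw [hamField, ← constMat_symp, jacobian_constMat_mulVec]

theorem jacobian_hamField_transpose_mul (H : MvPolynomial Idx ℝ) :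
    (jacobian (hamField H))ᵀ * symp _ = -(symp _ * jacobian (hamField H)) := by
  rw [jacobian_hamField, transpose_mul, symp_transpose, hessian_transpose, ← Matrix.mul_assoc,
    symp_mul_symp, Matrix.mul_assoc, neg_mul, symp_mul_symp]
  simp

theorem constMat_skewHamiltonian {A : Matrix Idx Idx ℝ} (hA : IsSkewHamiltonian A) :
    (constMat A)ᵀ * symp (MvPolynomial Idx ℝ) = symp _ * constMat A := by
  rw [← constMat_symp, ← constMat_transpose, ← constMat_mul, hA, constMat_mul]

/-- `Aᵀ` passes `J` as `A`, and the differential equations let `A` pass the Hesse matrix as `Aᵀ`. -/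
theorem constMat_transpose_mul_jacobian {A : Matrix Idx Idx ℝ} (hA : IsSkewHamiltonian A)
    {H : MvPolynomial Idx ℝ} (hPDE : SatisfiesPDE A H) :
    (constMat A)ᵀ * jacobian (hamField H) = jacobian (hamField H) * (constMat A)ᵀ := by
  rw [jacobian_hamField, ← Matrix.mul_assoc, constMat_skewHamiltonian hA, Matrix.mul_assoc, hPDE,
    Matrix.mul_assoc]

theorem isHomogeneous_hamField {H : MvPolynomial Idx ℝ} (hH : H.IsHomogeneous 3)
    (M : Matrix Idx Idx ℝ) (i : Idx) : ((constMat M *ᵥ gradient H) i).IsHomogeneous 2 := by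
  refine MvPolynomial.IsHomogeneous.sum _ _ _ fun k _ => ?_
  exact (MvPolynomial.isHomogeneous_C Idx (M i k)).mul (hH.pderiv (i := k))

theorem isHomogeneous_sq {R : Type*} [CommRing R] {M : Matrix Idx Idx (MvPolynomial Idx R)}
    (hM : ∀ i j, (M i j).IsHomogeneous 1) (i j : Idx) : ((M ^ 2) i j).IsHomogeneous 2 := by
  rw [pow_two, Matrix.mul_apply]
  exact MvPolynomial.IsHomogeneous.sum _ _ _ fun k _ => (hM i k).mul (hM k j)

theorem isHomogeneous_constMat_mul {R : Type*} [CommRing R] (N : Matrix Idx Idx R)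
    {M : Matrix Idx Idx (MvPolynomial Idx R)} {n : ℕ}
    (hM : ∀ i j, (M i j).IsHomogeneous n) (i j : Idx) : ((constMat N * M) i j).IsHomogeneous n := by
  rw [Matrix.mul_apply]
  refine MvPolynomial.IsHomogeneous.sum _ _ _ fun k _ => ?_
  have := (MvPolynomial.isHomogeneous_C Idx (N i k)).mul (hM k j)
  rwa [zero_add] at this

theorem isHomogeneous_trace {R : Type*} [CommRing R]
    {M : Matrix Idx Idx (MvPolynomial Idx R)} {n : ℕ}
    (hM : ∀ i j, (M i j).IsHomogeneous n) : M.trace.IsHomogeneous n :=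
  MvPolynomial.IsHomogeneous.sum _ _ _ fun k _ => hM k k

theorem isHomogeneous_smul {R : Type*} [CommRing R] (c : R) {p : MvPolynomial Idx R} {n : ℕ}
    (hp : p.IsHomogeneous n) : (c • p).IsHomogeneous n := by
  rw [MvPolynomial.smul_eq_C_mul]
  simpa using (MvPolynomial.isHomogeneous_C Idx c).mul hp

/-! ### The spectral expansion of the squared Jacobi matrix -/

theorem isHomogeneous_pZero {f : Idx → MvPolynomial Idx ℝ} (hf : ∀ i, (f i).IsHomogeneous 2) :
    (pZero f).IsHomogeneous 2 :=
  isHomogeneous_smul _ (isHomogeneous_trace (isHomogeneous_sq fun i j =>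
    ((hf i).pderiv (i := j)).map (algebraMap ℝ ℂ)))

theorem isHomogeneous_qPoly (A : Matrix Idx Idx ℝ) (ev : Fin 3 → ℂ)
    {f : Idx → MvPolynomial Idx ℝ} (hf : ∀ i, (f i).IsHomogeneous 2) (i : Fin 3) :
    (qPoly A ev f i).IsHomogeneous 2 :=
  isHomogeneous_smul _ (isHomogeneous_trace (isHomogeneous_constMat_mul (matB A ev i)ᵀ
    (isHomogeneous_sq fun i j => ((hf i).pderiv (i := j)).map (algebraMap ℝ ℂ))))

theorem toCPoly_mul (M N : Matrix Idx Idx (MvPolynomial Idx ℝ)) :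
    toCPoly (M * N) = toCPoly M * toCPoly N :=
  Matrix.map_mul

theorem toCPoly_symp : toCPoly (symp (MvPolynomial Idx ℝ)) = symp (MvPolynomial Idx ℂ) :=
  symp_map _

theorem toCPoly_constMat (M : Matrix Idx Idx ℝ) : toCPoly (constMat M) = constMat (toC M) := by
  ext1 i j
  exact MvPolynomial.map_C _ _

theorem toCPoly_transpose (M : Matrix Idx Idx (MvPolynomial Idx ℝ)) : toCPoly Mᵀ = (toCPoly M)ᵀ :=
  rfl

/-- `Bᵢ` is -1 on the `i`-th eigenspace and 1 on the others, so it is the reflection determined by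
the spectral projector `Uᵢ Vᵢ`. -/
theorem matB_eq_sub (A : Matrix Idx Idx ℝ) (ev : Fin 3 → ℂ) (hev : Function.Injective ev)
    {U : Fin 3 → Matrix Idx (Fin 2) ℂ} {V : Fin 3 → Matrix (Fin 2) Idx ℂ}
    (hU : ∀ i, toC A * U i = ev i • U i) (hUV : ∑ i, U i * V i = 1) (i : Fin 3) :
    matB A ev i = 1 - (2 : ℂ) • (U i * V i) := by
  have h : matB A ev i = ∑ j, matB A ev i * U j * V j := by
    simp only [Matrix.mul_assoc, ← Matrix.mul_sum, hUV, Matrix.mul_one]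
  rw [h, ← hUV]
  have h2 : ∀ j, matB A ev i * U j * V j
      = U j * V j - if j = i then (2 : ℂ) • (U i * V i) else 0 := by
    intro j
    rw [matB_mul_eigenvectors A ev hev (U j) j (hU j), Matrix.smul_mul]
    split_ifs with h
    · subst h; module
    · simp
  simp only [h2, Finset.sum_sub_distrib, Finset.sum_ite_eq', Finset.mem_univ, if_true]

theorem constMat_map_mul {R m n k : Type*} [CommRing R] [Fintype n] (M : Matrix m n R)
    (N : Matrix n k R) : (M * N).map (MvPolynomial.C : R →+* MvPolynomial Idx R)
      = M.map MvPolynomial.C * N.map MvPolynomial.C :=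
  Matrix.map_mul

theorem constMat_sub {R : Type*} [CommRing R] (M N : Matrix Idx Idx R) :
    constMat (M - N) = constMat M - constMat N :=
  map_sub (RingHom.mapMatrix (MvPolynomial.C : R →+* MvPolynomial Idx R)) M N

theorem constMat_add {R : Type*} [CommRing R] (M N : Matrix Idx Idx R) :
    constMat (M + N) = constMat M + constMat N :=
  map_add (RingHom.mapMatrix (MvPolynomial.C : R →+* MvPolynomial Idx R)) M N

theorem constMat_sum {R ι : Type*} [CommRing R] (s : Finset ι) (M : ι → Matrix Idx Idx R) :
    constMat (∑ i ∈ s, M i) = ∑ i ∈ s, constMat (M i) :=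
  map_sum (RingHom.mapMatrix (MvPolynomial.C : R →+* MvPolynomial Idx R)) M s

theorem constMat_pow {R : Type*} [CommRing R] (M : Matrix Idx Idx R) (n : ℕ) :
    constMat (M ^ n) = constMat M ^ n :=
  map_pow (RingHom.mapMatrix (MvPolynomial.C : R →+* MvPolynomial Idx R)) M n

theorem constMat_smul {R : Type*} [CommRing R] (c : R) (M : Matrix Idx Idx R) :
    constMat (c • M) = (MvPolynomial.C c : MvPolynomial Idx R) • constMat M := by
  ext1 i j
  simp [constMat]

theorem matB_transpose_mul_symp {A : Matrix Idx Idx ℝ} (hA : IsSkewHamiltonian A)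
    (ev : Fin 3 → ℂ) (i : Fin 3) :
    (matB A ev i)ᵀ * symp ℂ = symp ℂ * matB A ev i := by
  have hA' : (toC A)ᵀ * symp ℂ = symp ℂ * toC A := by
    have := congrArg (fun M : Matrix Idx Idx ℝ => M.map (algebraMap ℝ ℂ)) hA
    rw [Matrix.map_mul, Matrix.map_mul, symp_map, transpose_map] at this
    exact this
  have hA2 : (toC A)ᵀ ^ 2 * symp ℂ = symp ℂ * toC A ^ 2 := by
    rw [pow_two, Matrix.mul_assoc, hA', ← Matrix.mul_assoc, hA', Matrix.mul_assoc, ← pow_two]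
  simp only [matB, transpose_add, transpose_smul, transpose_one, transpose_pow, Matrix.add_mul,
    Matrix.mul_add, Matrix.smul_mul, Matrix.mul_smul, hA', hA2, Matrix.one_mul, Matrix.mul_one]

theorem constMat_matB_transpose (A : Matrix Idx Idx ℝ) (ev : Fin 3 → ℂ) (i : Fin 3) :
    (constMat (matB A ev i))ᵀ = (MvPolynomial.C (alphaC ev i) : MvPolynomial Idx ℂ) • 1
      + (MvPolynomial.C (betaC ev i) : MvPolynomial Idx ℂ) • (constMat (toC A))ᵀ
      + (MvPolynomial.C (gammaC ev i) : MvPolynomial Idx ℂ) • (constMat (toC A))ᵀ ^ 2 := by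
  simp only [matB, constMat_add, constMat_smul, constMat_one, constMat_pow, transpose_add,
    transpose_smul, transpose_one, transpose_pow]

/-- The expansion `(f')² = p₀ I + ∑ qᵢ Bᵢᵀ`. -/
theorem jacobian_sq_eq {A : Matrix Idx Idx ℝ} (hA : IsSkewHamiltonian A)
    {ev : Fin 3 → ℂ} (hev : Function.Injective ev)
    (hchar : (toC A).charpoly = ∏ i, (Polynomial.X - Polynomial.C (ev i)) ^ 2)
    {H : MvPolynomial Idx ℝ} (hPDE : SatisfiesPDE A H) :
    toCPoly (jacobian (hamField H)) ^ 2 = pZero (hamField H) • 1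
      + ∑ i, qPoly A ev (hamField H) i • (constMat (matB A ev i))ᵀ := by
  obtain ⟨U, V, hU, hVU, hUV⟩ := exists_eigenbasis A hA ev hev hchar
  set F := toCPoly (jacobian (hamField H)) with hF
  have hFJ : Fᵀ * symp _ = -(symp _ * F) := by
    have := congrArg toCPoly (jacobian_hamField_transpose_mul H)
    rw [← neg_mul, ← symp_transpose, toCPoly_mul, toCPoly_mul, toCPoly_transpose,
      toCPoly_transpose, toCPoly_symp, symp_transpose, neg_mul] at this
    exact this
  have hFA : (constMat (toC A))ᵀ * F = F * (constMat (toC A))ᵀ := by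
    have := congrArg toCPoly (constMat_transpose_mul_jacobian hA hPDE)
    rwa [toCPoly_mul, toCPoly_mul, toCPoly_transpose, toCPoly_constMat] at this
  have hFA2 : (constMat (toC A))ᵀ ^ 2 * F = F * (constMat (toC A))ᵀ ^ 2 :=
    ((show Commute _ _ from hFA).pow_left 2).eq
  have hFB : ∀ i, (constMat (matB A ev i))ᵀ * F = F * (constMat (matB A ev i))ᵀ := by
    intro i
    simp only [constMat_matB_transpose, Matrix.add_mul, Matrix.mul_add, Matrix.smul_mul,
      Matrix.mul_smul, hFA, hFA2, Matrix.one_mul, Matrix.mul_one]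
  -- The projectors are transposed because the Jacobi matrix commutes with `Aᵀ`, not with `A`.
  set E : Fin 3 → Matrix Idx Idx (MvPolynomial Idx ℂ) := fun i => constMat (U i * V i)ᵀ with hE
  have hB : ∀ i, (constMat (matB A ev i))ᵀ = 1 - (2 : MvPolynomial Idx ℂ) • E i := by
    intro i
    rw [matB_eq_sub A ev hev hU hUV, ← constMat_transpose, transpose_sub, constMat_sub,
      transpose_one, constMat_one, transpose_smul, constMat_smul, map_ofNat]
  have hEsum : E 0 + E 1 + E 2 = 1 := by
    rw [← Fin.sum_univ_three, hE, ← constMat_sum, ← transpose_sum, hUV, transpose_one,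
      constMat_one]
  have htwo : ∀ M N : Matrix Idx Idx (MvPolynomial Idx ℂ),
      (2 : MvPolynomial Idx ℂ) • M = (2 : MvPolynomial Idx ℂ) • N → M = N := by
    intro M N h
    ext1 i j
    have := congrFun (congrFun h i) j
    simpa using this
  have hEF : ∀ i, (2 : MvPolynomial Idx ℂ) • (E i * F ^ 2) = (E i * F ^ 2).trace • E i := by
    intro i
    have hEi : (V i)ᵀ.map (MvPolynomial.C : ℂ →+* MvPolynomial Idx ℂ)
        * (U i)ᵀ.map (MvPolynomial.C : ℂ →+* MvPolynomial Idx ℂ) = E i :=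
      (constMat_map_mul (V i)ᵀ (U i)ᵀ).symm.trans (by rw [← transpose_mul]; rfl)
    have hid : (U i)ᵀ.map (MvPolynomial.C : ℂ →+* MvPolynomial Idx ℂ)
        * (V i)ᵀ.map (MvPolynomial.C : ℂ →+* MvPolynomial Idx ℂ) = 1 := by
      refine (constMat_map_mul (U i)ᵀ (V i)ᵀ).symm.trans ?_
      rw [← transpose_mul, hVU, transpose_one]
      exact map_one (RingHom.mapMatrix (MvPolynomial.C : ℂ →+* MvPolynomial Idx ℂ))
    have := two_smul_projector_mul_sq F hFJ _ _ hid
    rw [hEi] at this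
    -- Both compatibilities of `E i` are those of `Bᵢᵀ = 1 - 2 Eᵢ`, after cancelling the identity
    -- and the factor 2.
    refine this (htwo _ _ ?_) (htwo _ _ ?_)
    · have h := hFB i
      rw [hB, Matrix.sub_mul, Matrix.mul_sub, Matrix.one_mul, Matrix.mul_one, sub_right_inj,
        Matrix.smul_mul, Matrix.mul_smul] at h
      exact h
    · have h := congrArg constMat (matB_transpose_mul_symp hA ev i)
      rw [constMat_mul, constMat_mul, constMat_symp, constMat_transpose, hB,
        ← transpose_transpose (constMat (matB A ev i)), hB, transpose_sub, transpose_one,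
        Matrix.sub_mul, Matrix.mul_sub, Matrix.one_mul, Matrix.mul_one, sub_right_inj,
        transpose_smul, Matrix.smul_mul, Matrix.mul_smul] at h
      exact h
  have h2C : ∀ c : ℂ, (MvPolynomial.C c : MvPolynomial Idx ℂ) * 8 = MvPolynomial.C (c * 8) := by
    intro c
    rw [MvPolynomial.C_mul, map_ofNat]
  set t : Fin 3 → MvPolynomial Idx ℂ := fun i => (E i * F ^ 2).trace with ht
  have hFsum : F ^ 2 = E 0 * F ^ 2 + E 1 * F ^ 2 + E 2 * F ^ 2 := by
    rw [← Matrix.add_mul, ← Matrix.add_mul, hEsum, Matrix.one_mul]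
  have htsum : (F ^ 2).trace = t 0 + t 1 + t 2 := by
    rw [ht, ← trace_add, ← trace_add, ← hFsum]
  have hp : 8 * pZero (hamField H) = t 0 + t 1 + t 2 := by
    rw [pZero, ← hF, ← htsum, MvPolynomial.smul_eq_C_mul, ← mul_assoc, mul_comm 8, h2C]
    norm_num
  have hq : ∀ i, 8 * qPoly A ev (hamField H) i = t 0 + t 1 + t 2 - 2 * t i := by
    intro i
    rw [qPoly, ← hF, ← htsum, MvPolynomial.smul_eq_C_mul, ← mul_assoc, mul_comm 8, h2C, hB,
      Matrix.sub_mul, trace_sub, Matrix.one_mul, Matrix.smul_mul, trace_smul]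
    norm_num
    rfl
  -- Multiplication by 8 clears the denominators of `p₀` and `qᵢ`. With `1 = E 0 + E 1 + E 2`, both
  -- sides become `4 ∑ tᵢ Eᵢ`.
  refine htwo _ _ (htwo _ _ (htwo _ _ ?_))
  rw [Fin.sum_univ_three, hB, hB, hB]
  have hL : (2 : MvPolynomial Idx ℂ) • (2 : MvPolynomial Idx ℂ) • (2 : MvPolynomial Idx ℂ) • F ^ 2
      = (4 : MvPolynomial Idx ℂ) • (t 0 • E 0 + t 1 • E 1 + t 2 • E 2) := by
    rw [ht, ← hEF, ← hEF, ← hEF]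
    conv_lhs => rw [hFsum]
    module
  rw [hL]
  have hR : ∀ (a b c d : MvPolynomial Idx ℂ) (X Y Z : Matrix Idx Idx (MvPolynomial Idx ℂ)),
      (2 : MvPolynomial Idx ℂ) • (2 : MvPolynomial Idx ℂ) • (2 : MvPolynomial Idx ℂ) •
        (a • (1 : Matrix Idx Idx (MvPolynomial Idx ℂ)) + (b • X + c • Y + d • Z))
      = (8 * a) • (1 : Matrix Idx Idx (MvPolynomial Idx ℂ))
        + ((8 * b) • X + (8 * c) • Y + (8 * d) • Z) := by
    intros; module
  rw [hR, hp, hq, hq, hq, ← hEsum]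
  module

theorem tensor_toCPoly (f : Idx → MvPolynomial Idx ℝ) (ε : ℝ) :
    toCPoly (tensor f ε) = symp _ - (ε : ℂ) ^ 2 • (toCPoly (jacobian f) ^ 2 * symp _) := by
  rw [tensor, ← toCPoly_symp, pow_two (toCPoly _), ← toCPoly_mul, ← toCPoly_mul, ← pow_two]
  generalize jacobian f ^ 2 * symp _ = N
  ext1 i j
  simp [toCPoly, MvPolynomial.smul_eq_C_mul]

/-! ### Descent of the coefficients from ℂ to ℝ -/

/-- Applied to eigenvectors, the relation gives a polynomial of degree at most two with three
distinct roots; divided differences then kill its coefficients. -/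
theorem linearIndependent_powers {A : Matrix Idx Idx ℝ}
    {ev : Fin 3 → ℂ} (hev : Function.Injective ev)
    {U : Fin 3 → Matrix Idx (Fin 2) ℂ} {V : Fin 3 → Matrix (Fin 2) Idx ℂ}
    (hU : ∀ i, toC A * U i = ev i • U i) (hVU : ∀ i, V i * U i = 1) (c₀ c₁ c₂ : ℂ)
    (h : c₀ • (1 : Matrix Idx Idx ℂ) + c₁ • toC A + c₂ • toC A ^ 2 = 0) :
    c₀ = 0 ∧ c₁ = 0 ∧ c₂ = 0 := by
  have hroot : ∀ i, c₀ + c₁ * ev i + c₂ * ev i ^ 2 = 0 := by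
    intro i
    have h2 : toC A ^ 2 * U i = (ev i ^ 2) • U i := by
      rw [pow_two, Matrix.mul_assoc, hU, Matrix.mul_smul, hU, smul_smul, pow_two]
    have h1 := congrArg (fun M => V i * (M * U i)) h
    simp only [Matrix.add_mul, Matrix.smul_mul, Matrix.one_mul, hU, h2, Matrix.mul_add,
      Matrix.mul_smul, hVU, Matrix.zero_mul, Matrix.mul_zero] at h1
    have := congrFun (congrFun h1 0) 0
    simpa [mul_comm] using this
  have h01 : ev 0 - ev 1 ≠ 0 := sub_ne_zero.2 fun h => absurd (hev h) (by decide)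
  have h12 : ev 1 - ev 2 ≠ 0 := sub_ne_zero.2 fun h => absurd (hev h) (by decide)
  have h02 : ev 0 - ev 2 ≠ 0 := sub_ne_zero.2 fun h => absurd (hev h) (by decide)
  have e1 : c₁ + c₂ * (ev 0 + ev 1) = 0 :=
    mul_left_cancel₀ h01 (by linear_combination hroot 0 - hroot 1)
  have e2 : c₁ + c₂ * (ev 0 + ev 2) = 0 :=
    mul_left_cancel₀ h02 (by linear_combination hroot 0 - hroot 2)
  have e3 : c₂ = 0 := mul_left_cancel₀ h12 (by linear_combination e1 - e2)
  have e4 : c₁ = 0 := by simpa [e3] using e1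
  exact ⟨by simpa [e3, e4] using hroot 0, e4, e3⟩

/-- If a real matrix of polynomials is a combination of `I`, `Aᵀ`, `(Aᵀ)²` with complex polynomial
coefficients, these have real coefficients. -/
theorem exists_real_coefficients {A : Matrix Idx Idx ℝ}
    {ev : Fin 3 → ℂ} (hev : Function.Injective ev)
    {U : Fin 3 → Matrix Idx (Fin 2) ℂ} {V : Fin 3 → Matrix (Fin 2) Idx ℂ}
    (hU : ∀ i, toC A * U i = ev i • U i) (hVU : ∀ i, V i * U i = 1)
    (N : Matrix Idx Idx (MvPolynomial Idx ℝ)) (p q r : MvPolynomial Idx ℂ)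
    (h : toCPoly N = p • 1 + q • (constMat (toC A))ᵀ + r • (constMat (toC A))ᵀ ^ 2) :
    ∃ p' q' r' : MvPolynomial Idx ℝ, MvPolynomial.map (algebraMap ℝ ℂ) p' = p ∧
      MvPolynomial.map (algebraMap ℝ ℂ) q' = q ∧ MvPolynomial.map (algebraMap ℝ ℂ) r' = r := by
  have key : ∀ m, (p.coeff m).im = 0 ∧ (q.coeff m).im = 0 ∧ (r.coeff m).im = 0 := by
    intro m
    have hpow : toC A ^ 2 = toC (A ^ 2) := (map_pow (RingHom.mapMatrix (algebraMap ℝ ℂ)) A 2).symm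
    have hC : ∀ (s : MvPolynomial Idx ℂ) (M : Matrix Idx Idx ℝ) (i j : Idx),
        ((s • (constMat (toC M))ᵀ) i j).coeff m = s.coeff m * (M j i : ℂ) := by
      intro s M i j
      change MvPolynomial.coeff m (s * MvPolynomial.C (M j i : ℂ)) = _
      rw [mul_comm, MvPolynomial.coeff_C_mul, mul_comm]
    have h1 : (1 : Matrix Idx Idx (MvPolynomial Idx ℂ)) = (constMat (toC 1))ᵀ := by
      have : toC 1 = 1 := map_one (RingHom.mapMatrix (algebraMap ℝ ℂ))
      rw [this, constMat_one, transpose_one]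
    rw [h1, ← transpose_pow, ← constMat_pow, hpow] at h
    -- `N` and `A` are real, so the imaginary parts at each monomial form a linear relation between
    -- `1`, `A`, `A²`. Reading the entry `(j, i)` undoes the transposes.
    have hre : ∀ i j : Idx, (p.coeff m).im * (1 : Matrix Idx Idx ℝ) i j + (q.coeff m).im * A i j
        + (r.coeff m).im * (A ^ 2) i j = 0 := by
      intro i j
      have := congrArg (fun M : Matrix Idx Idx (MvPolynomial Idx ℂ) => ((M j i).coeff m).im) h
      simp only [Matrix.add_apply, MvPolynomial.coeff_add, hC] at this
      rw [toCPoly, map_apply, MvPolynomial.coeff_map] at this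
      simpa using this.symm
    have hz : (((p.coeff m).im : ℂ)) • (1 : Matrix Idx Idx ℂ) + ((q.coeff m).im : ℂ) • toC A
        + ((r.coeff m).im : ℂ) • toC A ^ 2 = 0 := by
      ext i j
      have := congrArg (algebraMap ℝ ℂ) (hre i j)
      rw [hpow]
      have hone : (1 : Matrix Idx Idx ℂ) i j = (((1 : Matrix Idx Idx ℝ) i j : ℝ) : ℂ) := by
        simp only [one_apply]; split_ifs <;> simp
      simpa [hone, toC] using this
    obtain ⟨a, b, c⟩ := linearIndependent_powers hev hU hVU _ _ _ hz
    exact ⟨by exact_mod_cast a, by exact_mod_cast b, by exact_mod_cast c⟩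
  have hmem : ∀ s : MvPolynomial Idx ℂ, (∀ m, (s.coeff m).im = 0) →
      ∃ s' : MvPolynomial Idx ℝ, MvPolynomial.map (algebraMap ℝ ℂ) s' = s := by
    intro s hs
    refine MvPolynomial.mem_range_map_iff_coeffs_subset.2 ?_
    intro c hc
    obtain ⟨m, _, rfl⟩ := MvPolynomial.mem_coeffs_iff.1 hc
    exact ⟨(s.coeff m).re, Complex.ext (by simp) (by simp [hs m])⟩
  obtain ⟨p', hp⟩ := hmem p fun m => (key m).1
  obtain ⟨q', hq⟩ := hmem q fun m => (key m).2.1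
  obtain ⟨r', hr⟩ := hmem r fun m => (key m).2.2
  exact ⟨p', q', r', hp, hq, hr⟩

theorem isHomogeneous_of_map {p : MvPolynomial Idx ℝ} {n : ℕ}
    (hp : (MvPolynomial.map (algebraMap ℝ ℂ) p).IsHomogeneous n) : p.IsHomogeneous n := by
  intro d hd
  refine hp (d := d) ?_
  rw [MvPolynomial.coeff_map]
  simpa using hd

theorem toCPoly_injective : Function.Injective toCPoly :=
  Matrix.map_injective (MvPolynomial.map_injective _ (algebraMap ℝ ℂ).injective)

/-- The expansion `(f')² = p I + q Aᵀ + r (Aᵀ)²`. -/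
theorem exists_jacobian_sq_eq {A : Matrix Idx Idx ℝ} (hA : IsSkewHamiltonian A)
    {ev : Fin 3 → ℂ} (hev : Function.Injective ev)
    (hchar : (toC A).charpoly = ∏ i, (Polynomial.X - Polynomial.C (ev i)) ^ 2)
    {H : MvPolynomial Idx ℝ} (hH : H.IsHomogeneous 3) (hPDE : SatisfiesPDE A H) :
    ∃ p q r : MvPolynomial Idx ℝ,
      p.IsHomogeneous 2 ∧ q.IsHomogeneous 2 ∧ r.IsHomogeneous 2 ∧
      MvPolynomial.map (algebraMap ℝ ℂ) p
        = pZero (hamField H) + ∑ i, alphaC ev i • qPoly A ev (hamField H) i ∧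
      MvPolynomial.map (algebraMap ℝ ℂ) q = ∑ i, betaC ev i • qPoly A ev (hamField H) i ∧
      MvPolynomial.map (algebraMap ℝ ℂ) r = ∑ i, gammaC ev i • qPoly A ev (hamField H) i ∧
      jacobian (hamField H) ^ 2 = p • 1 + q • (constMat A)ᵀ + r • (constMat A)ᵀ ^ 2 := by
  obtain ⟨U, V, hU, hVU, hUV⟩ := exists_eigenbasis A hA ev hev hchar
  have hf2 : ∀ i, (hamField H i).IsHomogeneous 2 := by
    intro i
    rw [hamField, ← constMat_symp]
    exact isHomogeneous_hamField hH _ i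
  have hq2 := isHomogeneous_qPoly A ev hf2
  have hsq : toCPoly (jacobian (hamField H) ^ 2)
      = (pZero (hamField H) + ∑ i, alphaC ev i • qPoly A ev (hamField H) i) • 1
        + (∑ i, betaC ev i • qPoly A ev (hamField H) i) • (constMat (toC A))ᵀ
        + (∑ i, gammaC ev i • qPoly A ev (hamField H) i) • (constMat (toC A))ᵀ ^ 2 := by
    rw [pow_two, toCPoly_mul, ← pow_two, jacobian_sq_eq hA hev hchar hPDE]
    simp only [constMat_matB_transpose, MvPolynomial.smul_eq_C_mul, Fin.sum_univ_three]
    module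
  obtain ⟨p, q, r, hp, hq, hr⟩ := exists_real_coefficients hev hU hVU _ _ _ _ hsq
  refine ⟨p, q, r, isHomogeneous_of_map ?_, isHomogeneous_of_map ?_, isHomogeneous_of_map ?_,
    hp, hq, hr, toCPoly_injective ?_⟩
  · rw [hp]
    exact (isHomogeneous_pZero hf2).add
      (MvPolynomial.IsHomogeneous.sum _ _ _ fun i _ => isHomogeneous_smul _ (hq2 i))
  · rw [hq]
    exact MvPolynomial.IsHomogeneous.sum _ _ _ fun i _ => isHomogeneous_smul _ (hq2 i)
  · rw [hr]
    exact MvPolynomial.IsHomogeneous.sum _ _ _ fun i _ => isHomogeneous_smul _ (hq2 i)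
  · rw [hsq, ← hp, ← hq, ← hr, ← toCPoly_constMat]
    ext1 i j
    have h2 : (toCPoly (constMat A))ᵀ ^ 2 = toCPoly ((constMat A)ᵀ ^ 2) :=
      (map_pow (RingHom.mapMatrix (MvPolynomial.map (algebraMap ℝ ℂ))) (constMat A)ᵀ 2).symm
    rw [h2]
    simp [toCPoly, one_apply]
    split_ifs <;> simp

/-! ### Poisson tensors -/

theorem fderiv_apply_eq_dotProduct (F : Phase → ℝ) (x v : Phase) :
    fderiv ℝ F x v = partialD F x ⬝ᵥ v := by
  have := LinearMap.pi_apply_eq_sum_univ (fderiv ℝ F x).toLinearMap v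
  simp only [ContinuousLinearMap.coe_coe, smul_eq_mul] at this
  rw [this, dotProduct]
  refine Finset.sum_congr rfl fun i _ => ?_
  rw [mul_comm, partialD]
  congr 2
  ext j
  simp [Pi.single_apply, eq_comm]

theorem hasFDerivAt_partialD {F : Phase → ℝ} (hF : ContDiff ℝ ∞ F) (x : Phase) (j : Idx) :
    HasFDerivAt (fun y => partialD F y j)
      ((ContinuousLinearMap.apply ℝ ℝ (Pi.single j 1 : Phase)).comp (fderiv ℝ (fderiv ℝ F) x))
      x := by
  have h : HasFDerivAt (fderiv ℝ F) (fderiv ℝ (fderiv ℝ F) x) x :=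
    (((hF.fderiv_right (m := ∞) (by simp)).differentiable (by simp)).differentiableAt).hasFDerivAt
  exact (ContinuousLinearMap.apply ℝ ℝ (Pi.single j 1 : Phase)).hasFDerivAt.comp x h

/-- The directional derivative of a field of matrices. -/
def matDeriv (P : Phase → Matrix Idx Idx ℝ) (x v : Phase) : Matrix Idx Idx ℝ :=
  Matrix.of fun i j => fderiv ℝ (fun y => P y i j) x v

/-- The product rule, with skew-symmetry of `P` producing the sign of the last term. In this form
the second derivatives cancel in the cyclic sum. -/
theorem fderiv_bracket {P : Phase → Matrix Idx Idx ℝ}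
    (hP : ∀ i j, ContDiff ℝ ∞ fun x => P x i j) (hskew : ∀ x, (P x)ᵀ = -P x)
    {G K : Phase → ℝ} (hG : ContDiff ℝ ∞ G) (hK : ContDiff ℝ ∞ K) (x v : Phase) :
    fderiv ℝ (bracket P G K) x v
      = fderiv ℝ (fderiv ℝ G) x v (P x *ᵥ partialD K x)
        + partialD G x ⬝ᵥ (matDeriv P x v *ᵥ partialD K x)
        - fderiv ℝ (fderiv ℝ K) x v (P x *ᵥ partialD G x) := by
  have hb : bracket P G K
      = fun y => ∑ j, ∑ k, partialD G y j * (P y j k * partialD K y k) := by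
    funext y
    simp only [bracket, dotProduct, mulVec, Finset.mul_sum]
  have hPd : ∀ j k, HasFDerivAt (fun y => P y j k) (fderiv ℝ (fun y => P y j k) x) x := fun j k =>
    ((hP j k).differentiable (by simp)).differentiableAt.hasFDerivAt
  have hD := HasFDerivAt.fun_sum (u := Finset.univ) fun j _ =>
    HasFDerivAt.fun_sum (u := Finset.univ) fun k _ =>
      (hasFDerivAt_partialD hG x j).fun_mul ((hPd j k).fun_mul (hasFDerivAt_partialD hK x k))
  have hlin : ∀ (L : Phase →L[ℝ] ℝ) (w : Phase), L w = ∑ i, w i * L (Pi.single i 1) := by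
    intro L w
    have := fderiv_apply_eq_dotProduct L x w
    rw [ContinuousLinearMap.fderiv] at this
    rw [this, dotProduct]
    simp only [partialD, ContinuousLinearMap.fderiv, mul_comm]
  have e3 : fderiv ℝ (fderiv ℝ K) x v (P x *ᵥ partialD G x)
      = -∑ j, ∑ k, partialD G x j * (P x j k * fderiv ℝ (fderiv ℝ K) x v (Pi.single k 1)) := by
    rw [hlin, Finset.sum_comm, ← Finset.sum_neg_distrib]
    refine Finset.sum_congr rfl fun k _ => ?_
    rw [mulVec, dotProduct, Finset.sum_mul, ← Finset.sum_neg_distrib]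
    refine Finset.sum_congr rfl fun j _ => ?_
    have : P x k j = -P x j k := congrFun (congrFun (hskew x) j) k
    rw [this]; ring
  rw [e3, hb, hD.fderiv, hlin (fderiv ℝ (fderiv ℝ G) x v)]
  simp only [_root_.sum_apply, _root_.add_apply, _root_.smul_apply, ContinuousLinearMap.comp_apply,
    ContinuousLinearMap.apply_apply, smul_eq_mul, mulVec, dotProduct, matDeriv, of_apply,
    Finset.mul_sum, Finset.sum_mul, sub_neg_eq_add, ← Finset.sum_add_distrib]
  refine Finset.sum_congr rfl fun j _ => Finset.sum_congr rfl fun k _ => ?_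
  ring

/-- The Jacobi identity for a bracket follows from the Jacobi identity for the tensor. -/
theorem isPoissonTensor_of_cyclic {P : Phase → Matrix Idx Idx ℝ}
    (hP : ∀ i j, ContDiff ℝ ∞ fun x => P x i j) (hskew : ∀ x, (P x)ᵀ = -P x)
    (hcyc : ∀ x a b c, b ⬝ᵥ (matDeriv P x (P x *ᵥ a) *ᵥ c) + c ⬝ᵥ (matDeriv P x (P x *ᵥ b) *ᵥ a)
      + a ⬝ᵥ (matDeriv P x (P x *ᵥ c) *ᵥ b) = 0) : IsPoissonTensor P := by
  refine ⟨hP, hskew, fun F G K hF hG hK x => ?_⟩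
  have hbr : ∀ F Q : Phase → ℝ, bracket P F Q x = -fderiv ℝ Q x (P x *ᵥ partialD F x) := by
    intro F Q
    rw [bracket, dotProduct_mulVec_skew _ (hskew x), fderiv_apply_eq_dotProduct, dotProduct_comm]
  have hsymm : ∀ {F : Phase → ℝ}, ContDiff ℝ ∞ F → ∀ v w,
      fderiv ℝ (fderiv ℝ F) x v w = fderiv ℝ (fderiv ℝ F) x w v := by
    intro F hF v w
    exact hF.contDiffAt.isSymmSndFDerivAt (by simpa using ENat.LEInfty.out) v w
  rw [hbr F, hbr G, hbr K, fderiv_bracket hP hskew hG hK, fderiv_bracket hP hskew hK hF,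
    fderiv_bracket hP hskew hF hG]
  have h := hcyc x (partialD F x) (partialD G x) (partialD K x)
  -- Each of `F`, `G`, `K` contributes two second-derivative terms of opposite sign with swapped
  -- arguments; what remains is `hcyc`.
  rw [hsymm hF (P x *ᵥ partialD K x), hsymm hG (P x *ᵥ partialD F x),
    hsymm hK (P x *ᵥ partialD G x)]
  linarith

/-! ### The Jacobi matrix of a quadratic vector field as a linear function of the point -/

theorem evalMat_mul (M N : Matrix Idx Idx (MvPolynomial Idx ℝ)) (x : Phase) :
    evalMat (M * N) x = evalMat M x * evalMat N x :=
  Matrix.map_mul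

theorem evalMat_constMat (M : Matrix Idx Idx ℝ) (x : Phase) : evalMat (constMat M) x = M := by
  ext1 i j
  exact MvPolynomial.eval_C _

theorem evalMat_transpose (M : Matrix Idx Idx (MvPolynomial Idx ℝ)) (x : Phase) :
    evalMat Mᵀ x = (evalMat M x)ᵀ :=
  rfl

theorem evalMat_symp (x : Phase) : evalMat (symp _) x = symp ℝ :=
  symp_map _

theorem evalMat_tensor (f : Idx → MvPolynomial Idx ℝ) (ε : ℝ) (x : Phase) :
    evalMat (tensor f ε) x = symp ℝ - ε ^ 2 • (evalMat (jacobian f) x ^ 2 * symp ℝ) := by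
  rw [tensor, ← evalMat_symp x, pow_two (evalMat _ x), ← evalMat_mul, ← evalMat_mul, ← pow_two]
  generalize jacobian f ^ 2 * symp _ = N
  ext1 i j
  simp [evalMat, MvPolynomial.smul_eval]

theorem contDiff_eval (p : MvPolynomial Idx ℝ) :
    ContDiff ℝ ∞ fun x : Phase => MvPolynomial.eval x p := by
  induction p using MvPolynomial.induction_on with
  | C a => simpa using contDiff_const
  | add p q hp hq => simpa using hp.add hq
  | mul_X p i hp => simpa using hp.mul (contDiff_apply ℝ ℝ i)

theorem evalJacobian_mulVec {f : Idx → MvPolynomial Idx ℝ} (hf : ∀ i, (f i).IsHomogeneous 2)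
    (x y : Phase) : evalMat (jacobian f) x *ᵥ y
    = evalField f (x + y) - evalField f x - evalField f y :=
  (funext fun i => polarization (f i) (hf i) x y).symm

/-- Polarization is symmetric. This transfers linearity in the vector to linearity of `f'` in the
point. -/
theorem evalJacobian_mulVec_comm {f : Idx → MvPolynomial Idx ℝ} (hf : ∀ i, (f i).IsHomogeneous 2)
    (x y : Phase) :
    evalMat (jacobian f) x *ᵥ y = evalMat (jacobian f) y *ᵥ x := by
  rw [evalJacobian_mulVec hf, evalJacobian_mulVec hf, add_comm]
  abel

theorem evalJacobian_add {f : Idx → MvPolynomial Idx ℝ} (hf : ∀ i, (f i).IsHomogeneous 2)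
    (x y : Phase) : evalMat (jacobian f) (x + y)
    = evalMat (jacobian f) x + evalMat (jacobian f) y := by
  refine Matrix.toLin'.injective (LinearMap.ext fun v => ?_)
  simp only [toLin'_apply, add_mulVec]
  rw [evalJacobian_mulVec_comm hf, mulVec_add, evalJacobian_mulVec_comm hf v,
    evalJacobian_mulVec_comm hf v]

theorem evalJacobian_smul {f : Idx → MvPolynomial Idx ℝ} (hf : ∀ i, (f i).IsHomogeneous 2)
    (c : ℝ) (x : Phase) : evalMat (jacobian f) (c • x)
    = c • evalMat (jacobian f) x := by
  refine Matrix.toLin'.injective (LinearMap.ext fun v => ?_)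
  simp only [toLin'_apply, smul_mulVec]
  rw [evalJacobian_mulVec_comm hf, mulVec_smul, evalJacobian_mulVec_comm hf v]

/-- Since `f'` is linear in the point, the tensor is quadratic in `t` along `x + t v`; the
derivative is its coefficient of `t`. -/
theorem matDeriv_tensor {f : Idx → MvPolynomial Idx ℝ} (hf : ∀ i, (f i).IsHomogeneous 2)
    (ε : ℝ) (x v : Phase) : matDeriv (evalMat (tensor f ε)) x v
    = -(ε ^ 2 • ((evalMat (jacobian f) v * evalMat (jacobian f) x
        + evalMat (jacobian f) x * evalMat (jacobian f) v) * symp ℝ)) := by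
  ext1 i j
  rw [matDeriv, of_apply]
  have hd : DifferentiableAt ℝ (fun y => evalMat (tensor f ε) y i j) x :=
    ((contDiff_eval (tensor f ε i j)).differentiable (by simp)).differentiableAt
  rw [← hd.lineDeriv_eq_fderiv]
  refine HasLineDerivAt.lineDeriv ?_
  set X := evalMat (jacobian f) x
  set V := evalMat (jacobian f) v
  have h : ∀ t : ℝ, evalMat (tensor f ε) (x + t • v) i j
      = evalMat (tensor f ε) x i j + t * (-(ε ^ 2 • ((V * X + X * V) * symp ℝ))) i j
        + t ^ 2 * (-(ε ^ 2 • (V ^ 2 * symp ℝ))) i j := by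
    intro t
    have hm : evalMat (tensor f ε) (x + t • v) = evalMat (tensor f ε) x
        + t • (-(ε ^ 2 • ((V * X + X * V) * symp ℝ))) + t ^ 2 • (-(ε ^ 2 • (V ^ 2 * symp ℝ))) := by
      rw [evalMat_tensor, evalMat_tensor, evalJacobian_add hf, evalJacobian_smul hf]
      have : (X + t • V) ^ 2 = X ^ 2 + t • (V * X + X * V) + t ^ 2 • V ^ 2 := by
        simp only [pow_two, Matrix.add_mul, Matrix.mul_add, Matrix.smul_mul, Matrix.mul_smul,
          smul_add, smul_smul]
        abel
      rw [this, Matrix.add_mul, Matrix.add_mul, Matrix.smul_mul, Matrix.smul_mul]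
      module
    rw [hm]; rfl
  unfold HasLineDerivAt
  simp only [h]
  have h0 := ((hasDerivAt_id (0 : ℝ)).mul_const
    ((-(ε ^ 2 • ((V * X + X * V) * symp ℝ))) i j)).const_add (evalMat (tensor f ε) x i j)
  have h2 := ((hasDerivAt_pow 2 (0 : ℝ)).mul_const ((-(ε ^ 2 • (V ^ 2 * symp ℝ))) i j))
  have := h0.fun_add h2
  simpa using this

/-- If the squares of the Jacobi matrices commute with all Jacobi matrices, then
`J - ε² (f')² J` is a Poisson tensor. -/
theorem isPoissonTensor_tensor {f : Idx → MvPolynomial Idx ℝ} (hf : ∀ i, (f i).IsHomogeneous 2)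
    (hM : ∀ x, (evalMat (jacobian f) x)ᵀ * symp ℝ = -(symp ℝ * evalMat (jacobian f) x))
    (hcomm : ∀ x y, Commute (evalMat (jacobian f) x ^ 2) (evalMat (jacobian f) y)) (ε : ℝ) :
    IsPoissonTensor (evalMat (tensor f ε)) := by
  have hM2 : ∀ x, (evalMat (jacobian f) x ^ 2)ᵀ * symp ℝ
      = symp ℝ * evalMat (jacobian f) x ^ 2 := by
    intro x
    rw [transpose_pow, pow_two, Matrix.mul_assoc, hM, Matrix.mul_neg, ← Matrix.mul_assoc, hM,
      pow_two, neg_mul, neg_neg, Matrix.mul_assoc]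
  have hJM2 : ∀ x, symp ℝ * (evalMat (jacobian f) x ^ 2)ᵀ
      = evalMat (jacobian f) x ^ 2 * symp ℝ := by
    intro x
    have := congrArg (fun Z => symp ℝ * Z * symp ℝ) (hM2 x)
    simp only [Matrix.mul_assoc, symp_mul_symp] at this
    rw [← Matrix.mul_assoc (symp ℝ) (symp ℝ), symp_mul_symp] at this
    simpa using this
  refine isPoissonTensor_of_cyclic (fun i j => contDiff_eval (tensor f ε i j)) (fun x => ?_)
    fun x a b c => ?_
  · rw [evalMat_tensor, transpose_sub, transpose_smul, transpose_mul, symp_transpose, neg_mul,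
      hJM2]
    module
  set M := fun x => evalMat (jacobian f) x
  -- The tensor at `x` is `K J`, and `K` commutes with every `M y`.
  set K := 1 - ε ^ 2 • M x ^ 2 with hK
  have hKM : ∀ y, Commute K (M y) := fun y =>
    (Commute.one_left _).sub_left ((hcomm x y).smul_left _)
  have hP : ∀ a, evalMat (tensor f ε) x *ᵥ a = K *ᵥ (symp ℝ *ᵥ a) := by
    intro a
    rw [evalMat_tensor, mulVec_mulVec, hK, Matrix.sub_mul, Matrix.one_mul, Matrix.smul_mul]
  -- On a vector `v`: `M(Ku) v = M(v) K u = K M(v) u = K M(u) v`.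
  have hMK : ∀ u, M (K *ᵥ u) = K * M u := by
    intro u
    refine Matrix.toLin'.injective (LinearMap.ext fun v => ?_)
    simp only [toLin'_apply]
    rw [show M (K *ᵥ u) *ᵥ v = M v *ᵥ (K *ᵥ u) from evalJacobian_mulVec_comm hf _ _,
      mulVec_mulVec, ← (hKM v).eq, ← mulVec_mulVec, ← mulVec_mulVec,
      show M v *ᵥ u = M u *ᵥ v from evalJacobian_mulVec_comm hf _ _]
  have hJJ : ∀ u w : Phase, u ⬝ᵥ w = (symp ℝ *ᵥ u) ⬝ᵥ (symp ℝ *ᵥ w) := by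
    intro u w
    rw [dotProduct_mulVec, ← mulVec_transpose, symp_transpose, mulVec_mulVec, neg_mul,
      symp_mul_symp]
    simp
  have hskew : ∀ L : Matrix Idx Idx ℝ, Lᵀ * symp ℝ = -(symp ℝ * L) → ∀ u w : Phase,
      u ⬝ᵥ (symp ℝ *ᵥ (L *ᵥ w)) = -((L *ᵥ u) ⬝ᵥ (symp ℝ *ᵥ w)) := by
    intro L hL u w
    rw [mulVec_mulVec, ← neg_eq_iff_eq_neg.2 hL, neg_mulVec, dotProduct_neg, ← mulVec_mulVec,
      dotProduct_mulVec, vecMul_transpose]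
  have hL : (M x * K)ᵀ * symp ℝ = -(symp ℝ * (M x * K)) := by
    have hKJ : Kᵀ * symp ℝ = symp ℝ * K := by
      rw [hK, transpose_sub, transpose_smul, transpose_one, Matrix.sub_mul, Matrix.mul_sub,
        Matrix.smul_mul, hM2, Matrix.mul_smul, Matrix.one_mul, Matrix.mul_one]
    rw [transpose_mul, Matrix.mul_assoc, hM, Matrix.mul_neg, ← Matrix.mul_assoc, hKJ,
      Matrix.mul_assoc, (hKM x).eq]
  -- Each term is `ε² (T(a,b,c) - T(a,c,b))`, where `T(a,b,c)` pairs `M(Ja) Jb` with `M(x) K Jc` in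
  -- the symplectic form. As `T` is symmetric in its first two arguments, the cyclic sum vanishes.
  have hterm : ∀ a b c : Phase, b ⬝ᵥ (matDeriv (evalMat (tensor f ε)) x
        (evalMat (tensor f ε) x *ᵥ a) *ᵥ c)
      = ε ^ 2 * (((M (symp ℝ *ᵥ a)) *ᵥ (symp ℝ *ᵥ b)) ⬝ᵥ
            (symp ℝ *ᵥ ((M x * K) *ᵥ (symp ℝ *ᵥ c)))
          - ((M (symp ℝ *ᵥ a)) *ᵥ (symp ℝ *ᵥ c)) ⬝ᵥ
            (symp ℝ *ᵥ ((M x * K) *ᵥ (symp ℝ *ᵥ b)))) := by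
    intro a b c
    rw [hP, matDeriv_tensor hf]
    change b ⬝ᵥ (-(ε ^ 2 • ((M (K *ᵥ (symp ℝ *ᵥ a)) * M x
      + M x * M (K *ᵥ (symp ℝ *ᵥ a))) * symp ℝ)) *ᵥ c) = _
    rw [hMK, neg_mulVec, smul_mulVec, dotProduct_neg, dotProduct_smul, hJJ, ← mulVec_mulVec]
    generalize symp ℝ *ᵥ a = a'
    generalize symp ℝ *ᵥ b = b'
    generalize symp ℝ *ᵥ c = c'
    have e1 : K * M a' * M x = M a' * (M x * K) := by
      rw [(hKM a').eq, Matrix.mul_assoc, (hKM x).eq]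
    have e2 : (M a' * (M x * K) + M x * (K * M a')) *ᵥ c'
        = M a' *ᵥ ((M x * K) *ᵥ c') + (M x * K) *ᵥ (M a' *ᵥ c') := by
      rw [add_mulVec, mulVec_mulVec, mulVec_mulVec, Matrix.mul_assoc (M x)]
    rw [e1, e2, mulVec_add, dotProduct_add, hskew (M a') (hM a'), hskew (M x * K) hL b',
      dotProduct_mulVec_skew _ (symp_transpose ℝ) (_ *ᵥ b') (M a' *ᵥ c'),
      dotProduct_comm _ (M a' *ᵥ c')]
    simp only [smul_eq_mul]
    ring
  rw [hterm, hterm, hterm]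
  have hs : ∀ u w, M u *ᵥ w = M w *ᵥ u := evalJacobian_mulVec_comm hf
  rw [hs (symp ℝ *ᵥ b) (symp ℝ *ᵥ a), hs (symp ℝ *ᵥ c) (symp ℝ *ᵥ a),
    hs (symp ℝ *ᵥ c) (symp ℝ *ᵥ b)]
  ring

theorem smul_matrix_eq_C_smul {R : Type*} [CommRing R] (c : R)
    (M : Matrix Idx Idx (MvPolynomial Idx R)) :
    c • M = (MvPolynomial.C c : MvPolynomial Idx R) • M :=
  (algebraMap_smul (MvPolynomial Idx R) c M).symm

/-! ### The Kahan map -/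

theorem one_sub_smul_evalMat (M : Matrix Idx Idx (MvPolynomial Idx ℝ)) (ε : ℝ) (x : Phase) :
    1 - ε • evalMat M x = evalMat (1 - (MvPolynomial.C ε : MvPolynomial Idx ℝ) • M) x := by
  ext1 i j
  simp [evalMat, one_apply, apply_ite (MvPolynomial.eval x)]

theorem isOpen_kahanDomain (f : Idx → MvPolynomial Idx ℝ) (ε : ℝ) :
    IsOpen (kahanDomain f ε) := by
  have h : ∀ x, (1 - ε • evalMat (jacobian f) x).det
      = MvPolynomial.eval x (1 - (MvPolynomial.C ε : MvPolynomial Idx ℝ) • jacobian f).det := fun x => by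
    rw [one_sub_smul_evalMat, RingHom.map_det]; rfl
  simp only [kahanDomain, h]
  exact isOpen_ne_fun (contDiff_eval _).continuous continuous_const

/-- By the adjugate formula the components are rational functions whose denominator is the
determinant defining the domain. -/
theorem contDiffOn_kahanMap (f : Idx → MvPolynomial Idx ℝ) (ε : ℝ) :
    ContDiffOn ℝ ∞ (kahanMap f ε) (kahanDomain f ε) := by
  set N := 1 - (MvPolynomial.C ε : MvPolynomial Idx ℝ) • jacobian f with hN
  have hdet : ∀ x, (1 - ε • evalMat (jacobian f) x).det = MvPolynomial.eval x N.det := fun x => by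
    rw [one_sub_smul_evalMat, RingHom.map_det]; rfl
  have hadj : ∀ x, (1 - ε • evalMat (jacobian f) x).adjugate *ᵥ evalField f x
      = fun i => MvPolynomial.eval x ((N.adjugate *ᵥ f) i) := fun x => by
    rw [one_sub_smul_evalMat]
    have : (evalMat N x).adjugate = evalMat N.adjugate x :=
      ((MvPolynomial.eval x).map_adjugate N).symm
    rw [this]
    funext i
    simp [mulVec, dotProduct, evalMat, evalField]
  refine contDiffOn_pi.2 fun i => ?_
  have hk : ∀ x, kahanMap f ε x i = x i
      + 2 * ε * ((MvPolynomial.eval x N.det)⁻¹ * MvPolynomial.eval x ((N.adjugate *ᵥ f) i)) := by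
    intro x
    rw [kahanMap, Matrix.inv_def, Ring.inverse_eq_inv', smul_mulVec, hadj, hdet]
    simp
  simp only [hk]
  refine (contDiff_apply ℝ ℝ i).contDiffOn.add (contDiffOn_const.mul (ContDiffOn.mul
    ((contDiff_eval _).contDiffOn.inv fun x hx => ?_) (contDiff_eval _).contDiffOn))
  rw [← hdet]; exact hx

/-- This implicit form can be differentiated without differentiating a matrix inverse. -/
theorem kahanMap_sub {f : Idx → MvPolynomial Idx ℝ} (hf : ∀ i, (f i).IsHomogeneous 2) {ε : ℝ}
    {x : Phase} (hx : x ∈ kahanDomain f ε) :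
    kahanMap f ε x - ε • (evalMat (jacobian f) x *ᵥ kahanMap f ε x) = x := by
  have h := (isKahanStep_iff f hf ε x hx _).2 rfl
  rw [IsKahanStep, ← evalJacobian_mulVec hf, smul_smul] at h
  rw [show 2 * ε * (1 / 2) = ε by ring] at h
  rw [← h]
  abel

/-- The derivative of the Kahan map. -/
theorem fderiv_kahanMap {f : Idx → MvPolynomial Idx ℝ} (hf : ∀ i, (f i).IsHomogeneous 2) {ε : ℝ}
    {x : Phase} (hx : x ∈ kahanDomain f ε) (v : Phase) :
    (1 - ε • evalMat (jacobian f) x) *ᵥ fderiv ℝ (kahanMap f ε) x v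
      = (1 + ε • evalMat (jacobian f) (kahanMap f ε x)) *ᵥ v := by
  have hnhds : kahanDomain f ε ∈ nhds x := (isOpen_kahanDomain f ε).mem_nhds hx
  have hD : HasFDerivAt (kahanMap f ε) (fderiv ℝ (kahanMap f ε) x) x :=
    (((contDiffOn_kahanMap f ε).contDiffAt hnhds).differentiableAt (by simp)).hasFDerivAt
  let B₀ : Phase →ₗ[ℝ] Phase →ₗ[ℝ] Phase :=
    LinearMap.mk₂ ℝ (fun y z => evalMat (jacobian f) y *ᵥ z)
      (fun y y' z => by rw [evalJacobian_add hf, add_mulVec])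
      (fun c y z => by rw [evalJacobian_smul hf, smul_mulVec])
      (fun y z z' => mulVec_add _ _ _) (fun c y z => mulVec_smul _ _ _)
  let B := B₀.toContinuousBilinearMap
  have h1 := hD.sub ((B.hasFDerivAt_of_bilinear (hasFDerivAt_id x) hD).const_smul ε)
  have h2 : HasFDerivAt (fun z : Phase => z) (ContinuousLinearMap.id ℝ Phase) x := hasFDerivAt_id x
  have h3 := h2.congr_of_eventuallyEq (f₁ := fun z =>
    kahanMap f ε z - ε • (evalMat (jacobian f) z *ᵥ kahanMap f ε z))
    (Filter.eventually_of_mem hnhds fun z hz => kahanMap_sub hf hz)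
  have h4 := DFunLike.congr_fun (h1.unique h3) v
  change fderiv ℝ (kahanMap f ε) x v - ε • (evalMat (jacobian f) x *ᵥ fderiv ℝ (kahanMap f ε) x v
    + evalMat (jacobian f) v *ᵥ kahanMap f ε x) = v at h4
  -- Symmetry rewrites `f'(v) Φ(x)` as `f'(Φ(x)) v`, the source of the factor `1 + ε f'(Φ(x))`.
  rw [evalJacobian_mulVec_comm hf v] at h4
  rw [sub_mulVec, add_mulVec, one_mulVec, one_mulVec, smul_mulVec, smul_mulVec]
  rw [smul_add, sub_eq_iff_eq_add] at h4
  rw [sub_eq_iff_eq_add]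
  exact h4.trans (by abel)

theorem partialD_comp {F : Phase → ℝ} {Φ : Phase → Phase} {x : Phase}
    (hF : DifferentiableAt ℝ F (Φ x)) (hΦ : DifferentiableAt ℝ Φ x) :
    partialD (F ∘ Φ) x
      = (LinearMap.toMatrix' (fderiv ℝ Φ x).toLinearMap)ᵀ *ᵥ partialD F (Φ x) := by
  funext i
  rw [partialD, fderiv_comp x hF hΦ, ContinuousLinearMap.comp_apply, fderiv_apply_eq_dotProduct,
    mulVec, dotProduct_comm]
  congr 1

/-- The algebraic identity behind the Poisson property of the Kahan map. -/
theorem kahan_matrix_identity {X Y D : Matrix Idx Idx ℝ} {ε : ℝ}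
    (hX : Xᵀ * symp ℝ = -(symp ℝ * X)) (hY : Yᵀ * symp ℝ = -(symp ℝ * Y))
    (hXY : Commute (X ^ 2) Y) (hYX : Commute (Y ^ 2) X)
    (hdet : (1 - ε • X).det ≠ 0) (hD : (1 - ε • X) * D = 1 + ε • Y) :
    D * (symp ℝ - ε ^ 2 • (X ^ 2 * symp ℝ)) * Dᵀ = symp ℝ - ε ^ 2 • (Y ^ 2 * symp ℝ) := by
  have hsymm : ∀ Z : Matrix Idx Idx ℝ, Zᵀ * symp ℝ = -(symp ℝ * Z) →
      symp ℝ * Zᵀ = -(Z * symp ℝ) := by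
    intro Z hZ
    have := congrArg (fun W => symp ℝ * W * symp ℝ) hZ
    simp only [Matrix.mul_assoc, symp_mul_symp, Matrix.mul_neg, Matrix.neg_mul] at this
    rw [← Matrix.mul_assoc (symp ℝ) (symp ℝ), symp_mul_symp] at this
    exact neg_eq_iff_eq_neg.1 (by simpa using this)
  have hfac : ∀ Z : Matrix Idx Idx ℝ, (1 - ε • Z) * (1 + ε • Z) = 1 - ε ^ 2 • Z ^ 2 := by
    intro Z
    simp only [Matrix.sub_mul, Matrix.mul_add, Matrix.one_mul, Matrix.mul_one, Matrix.smul_mul,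
      Matrix.mul_smul, pow_two]
    module
  have hfac' : ∀ Z : Matrix Idx Idx ℝ, (1 + ε • Z) * (1 - ε • Z) = 1 - ε ^ 2 • Z ^ 2 := by
    intro Z
    simp only [Matrix.add_mul, Matrix.mul_sub, Matrix.one_mul, Matrix.mul_one, Matrix.smul_mul,
      Matrix.mul_smul, pow_two]
    module
  have hPX : symp ℝ - ε ^ 2 • (X ^ 2 * symp ℝ) = (1 - ε ^ 2 • X ^ 2) * symp ℝ := by
    rw [Matrix.sub_mul, Matrix.one_mul, Matrix.smul_mul]
  have hPY : symp ℝ - ε ^ 2 • (Y ^ 2 * symp ℝ) = (1 - ε ^ 2 • Y ^ 2) * symp ℝ := by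
    rw [Matrix.sub_mul, Matrix.one_mul, Matrix.smul_mul]
  have hNT : symp ℝ * (1 - ε • X)ᵀ = (1 + ε • X) * symp ℝ := by
    rw [transpose_sub, transpose_smul, transpose_one, Matrix.mul_sub, Matrix.mul_smul, hsymm X hX,
      Matrix.mul_one, Matrix.add_mul, Matrix.one_mul, Matrix.smul_mul]
    module
  have hQT : symp ℝ * (1 + ε • Y)ᵀ = (1 - ε • Y) * symp ℝ := by
    rw [transpose_add, transpose_smul, transpose_one, Matrix.mul_add, Matrix.mul_smul, hsymm Y hY,
      Matrix.mul_one, Matrix.sub_mul, Matrix.one_mul, Matrix.smul_mul]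
    module
  have hc1 : Commute (1 - ε ^ 2 • X ^ 2) (1 + ε • Y) :=
    ((Commute.one_left _).sub_left (((Commute.one_right _).add_right
      (hXY.smul_right ε)).smul_left _))
  have hc2 : Commute (1 - ε ^ 2 • Y ^ 2) (1 - ε • X) :=
    ((Commute.one_left _).sub_left (((Commute.one_right _).sub_right
      (hYX.smul_right ε)).smul_left _))
  have hc3 : Commute (1 - ε ^ 2 • Y ^ 2) (1 - ε ^ 2 • X ^ 2) :=
    ((Commute.one_left _).sub_left (((Commute.one_right _).sub_right
      ((hYX.pow_right 2).smul_right _)).smul_left _))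
  have hunit : IsUnit (1 - ε • X) := (isUnit_iff_isUnit_det _).2 (isUnit_iff_ne_zero.2 hdet)
  have hunit' : IsUnit (1 - ε • X)ᵀ := (isUnit_transpose _).2 hunit
  -- Multiplying by `1 - ε X` on the left and its transpose on the right removes `D` through `hD`.
  -- Moving a transpose past `J` flips the sign of `ε`, so the factors pair up to `1 - ε² X²` and `1
  -- - ε² Y²`.
  refine hunit.mul_left_cancel (hunit'.mul_right_cancel ?_)
  rw [hPX, hPY]
  calc (1 - ε • X) * (D * ((1 - ε ^ 2 • X ^ 2) * symp ℝ) * Dᵀ) * (1 - ε • X)ᵀ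
      = ((1 - ε • X) * D) * (1 - ε ^ 2 • X ^ 2) * (symp ℝ * ((1 - ε • X) * D)ᵀ) := by
        rw [transpose_mul]; simp only [Matrix.mul_assoc]
    _ = (1 - ε ^ 2 • X ^ 2) * ((1 + ε • Y) * (1 - ε • Y)) * symp ℝ := by
        rw [hD, hQT, ← hc1.eq]; simp only [Matrix.mul_assoc]
    _ = (1 - ε ^ 2 • Y ^ 2) * ((1 - ε • X) * (1 + ε • X)) * symp ℝ := by
        rw [hfac, hfac', hc3.eq]
    _ = (1 - ε • X) * ((1 - ε ^ 2 • Y ^ 2) * symp ℝ) * (1 - ε • X)ᵀ := by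
        rw [Matrix.mul_assoc _ _ (1 - ε • X)ᵀ, Matrix.mul_assoc _ (symp ℝ) (1 - ε • X)ᵀ, hNT,
          ← Matrix.mul_assoc, ← Matrix.mul_assoc, hc2.eq]
        simp only [Matrix.mul_assoc]

/-- If the squares of the Jacobi matrices commute with all Jacobi matrices, then the Kahan map is
Poisson for `J - ε² (f')² J`. -/
theorem isPoissonMapOn_kahanMap {f : Idx → MvPolynomial Idx ℝ} (hf : ∀ i, (f i).IsHomogeneous 2)
    (hM : ∀ x, (evalMat (jacobian f) x)ᵀ * symp ℝ = -(symp ℝ * evalMat (jacobian f) x))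
    (hcomm : ∀ x y, Commute (evalMat (jacobian f) x ^ 2) (evalMat (jacobian f) y)) (ε : ℝ) :
    IsPoissonMapOn (evalMat (tensor f ε)) (kahanMap f ε) (kahanDomain f ε) := by
  refine ⟨isOpen_kahanDomain f ε, contDiffOn_kahanMap f ε, fun F G hF hG x hx => ?_⟩
  have hΦ : DifferentiableAt ℝ (kahanMap f ε) x :=
    ((contDiffOn_kahanMap f ε).contDiffAt ((isOpen_kahanDomain f ε).mem_nhds hx)).differentiableAt
      (by simp)
  set D := LinearMap.toMatrix' (fderiv ℝ (kahanMap f ε) x).toLinearMap with hDdef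
  have hD : (1 - ε • evalMat (jacobian f) x) * D
      = 1 + ε • evalMat (jacobian f) (kahanMap f ε x) := by
    refine Matrix.toLin'.injective (LinearMap.ext fun v => ?_)
    simp only [toLin'_apply]
    rw [← mulVec_mulVec, ← fderiv_kahanMap hf hx, hDdef, LinearMap.toMatrix'_mulVec]
    rfl
  rw [bracket, bracket, partialD_comp (hF.differentiable (by simp)).differentiableAt hΦ,
    partialD_comp (hG.differentiable (by simp)).differentiableAt hΦ, ← hDdef, mulVec_transpose,
    ← dotProduct_mulVec, mulVec_mulVec, mulVec_mulVec, evalMat_tensor,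
    evalMat_tensor, kahan_matrix_identity (hM x) (hM _) (hcomm x _) (hcomm _ x) hx hD]

end KahanPoisson

end

/-! ### The Poisson structure shared by `f` and its associated fields -/

open KahanPoisson in
theorem theorem8p1
    (A : Matrix Idx Idx ℝ) (hA : IsSkewHamiltonian A)
    (ev : Fin 3 → ℂ) (hev : Function.Injective ev)
    (hchar : (toC A).charpoly = ∏ i, (Polynomial.X - Polynomial.C (ev i)) ^ 2)
    (H : MvPolynomial Idx ℝ) (hH : H.IsHomogeneous 3) (hPDE : SatisfiesPDE A H)
    (f : Idx → MvPolynomial Idx ℝ) (hf : f = hamField H) (ε : ℝ) :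
    -- `Π` is a Poisson tensor
    IsPoissonTensor (evalMat (tensor f ε)) ∧
    -- `Φ_f` is Poisson
    IsPoissonMapOn (evalMat (tensor f ε)) (kahanMap f ε) (kahanDomain f ε) ∧
    -- `Φ_g` is Poisson for every `g` associated to `f`
    (∀ g, IsAssociated A H g →
      IsPoissonMapOn (evalMat (tensor f ε)) (kahanMap g ε) (kahanDomain g ε)) ∧
    -- `p₀` and `qᵢ` are quadratic, and `Π = (1 - ε² p₀) J - ε² ∑ qᵢ Bᵢᵀ J`
    (pZero f).IsHomogeneous 2 ∧ (∀ i, (qPoly A ev f i).IsHomogeneous 2) ∧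
    toCPoly (tensor f ε) =
      (1 - (ε : ℂ) ^ 2 • pZero f) • symp (MvPolynomial Idx ℂ)
        - (ε : ℂ) ^ 2 • ∑ i, qPoly A ev f i •
            ((constMat (matB A ev i))ᵀ * symp (MvPolynomial Idx ℂ)) ∧
    -- `Π = (1 - ε² p) J - ε² q Aᵀ J - ε² r (Aᵀ)² J` with `p`, `q`, `r` real and quadratic
    ∃ p q r : MvPolynomial Idx ℝ,
      p.IsHomogeneous 2 ∧ q.IsHomogeneous 2 ∧ r.IsHomogeneous 2 ∧
      MvPolynomial.map (algebraMap ℝ ℂ) p = pZero f + ∑ i, alphaC ev i • qPoly A ev f i ∧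
      MvPolynomial.map (algebraMap ℝ ℂ) q = ∑ i, betaC ev i • qPoly A ev f i ∧
      MvPolynomial.map (algebraMap ℝ ℂ) r = ∑ i, gammaC ev i • qPoly A ev f i ∧
      tensor f ε =
        (1 - ε ^ 2 • p) • symp (MvPolynomial Idx ℝ)
          - ε ^ 2 • q • ((constMat A)ᵀ * symp (MvPolynomial Idx ℝ))
          - ε ^ 2 • r • ((constMat A)ᵀ ^ 2 * symp (MvPolynomial Idx ℝ)) := by
  subst hf
  have hf2 : ∀ i, (hamField H i).IsHomogeneous 2 := by
    intro i
    rw [hamField, ← constMat_symp]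
    exact isHomogeneous_hamField hH _ i
  obtain ⟨p, q, r, hp2, hq2, hr2, hp, hq, hr, hsq⟩ := exists_jacobian_sq_eq hA hev hchar hH hPDE
  set M := fun x => evalMat (jacobian (hamField H)) x with hMdef
  have hM : ∀ x, (M x)ᵀ * symp ℝ = -(symp ℝ * M x) := by
    intro x
    have := congrArg (fun N => evalMat N x) (jacobian_hamField_transpose_mul H)
    simp only [← neg_mul, ← symp_transpose, evalMat_mul, evalMat_transpose, evalMat_symp] at this
    rw [symp_transpose, neg_mul] at this
    exact this
  have hMA : ∀ x, Commute Aᵀ (M x) := by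
    intro x
    have := congrArg (fun N => evalMat N x) (constMat_transpose_mul_jacobian hA hPDE)
    simp only [evalMat_mul, evalMat_transpose, evalMat_constMat] at this
    exact this
  have hMsq : ∀ x, M x ^ 2 = MvPolynomial.eval x p • (1 : Matrix Idx Idx ℝ)
      + MvPolynomial.eval x q • Aᵀ + MvPolynomial.eval x r • Aᵀ ^ 2 := by
    intro x
    have h2 : (Aᵀ ^ 2 : Matrix Idx Idx ℝ) = evalMat ((constMat A)ᵀ ^ 2) x := by
      rw [pow_two, pow_two, evalMat_mul, evalMat_transpose, evalMat_constMat]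
    have h1 : (1 : Matrix Idx Idx ℝ) = evalMat 1 x :=
      (map_one (RingHom.mapMatrix (MvPolynomial.eval x))).symm
    have h3 : Aᵀ = evalMat (constMat A)ᵀ x := by rw [evalMat_transpose, evalMat_constMat]
    rw [hMdef]
    change evalMat _ x ^ 2 = _
    rw [pow_two, ← evalMat_mul, ← pow_two, hsq, h2, h1, h3]
    generalize (constMat A)ᵀ ^ 2 = X
    generalize (constMat A)ᵀ = Y
    generalize (1 : Matrix Idx Idx (MvPolynomial Idx ℝ)) = Z
    ext1 i j
    simp [evalMat]
  have hpoly : ∀ (N : Matrix Idx Idx ℝ) (a b c : ℝ), Commute Aᵀ N →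
      Commute (a • (1 : Matrix Idx Idx ℝ) + b • Aᵀ + c • Aᵀ ^ 2) N := fun N a b c h =>
    (((Commute.one_left N).smul_left a).add_left (h.smul_left b)).add_left
      ((h.pow_left 2).smul_left c)
  -- `M(x)²` is a polynomial in `Aᵀ`, and `Aᵀ` commutes with every `M(y)`.
  have hcomm : ∀ x y, Commute (M x ^ 2) (M y) := by
    intro x y
    rw [hMsq]
    exact hpoly _ _ _ _ (hMA y)
  refine ⟨isPoissonTensor_tensor hf2 hM hcomm ε, isPoissonMapOn_kahanMap hf2 hM hcomm ε, ?_,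
    isHomogeneous_pZero hf2, isHomogeneous_qPoly A ev hf2, ?_,
    p, q, r, hp2, hq2, hr2, hp, hq, hr, ?_⟩
  · rintro g ⟨α, β, γ, B, hB, hB2, rfl⟩
    have hBT : Bᵀ = α • (1 : Matrix Idx Idx ℝ) + β • Aᵀ + γ • Aᵀ ^ 2 := by
      rw [hB]; simp only [transpose_add, transpose_smul, transpose_one, transpose_pow]
    have hBM : ∀ x, Commute Bᵀ (M x) := fun x => hBT ▸ hpoly _ _ _ _ (hMA x)
    have hBJ : Bᵀ * symp ℝ = symp ℝ * B := by
      have hA2 : Aᵀ ^ 2 * symp ℝ = symp ℝ * A ^ 2 := by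
        rw [pow_two, Matrix.mul_assoc, hA, ← Matrix.mul_assoc, hA, Matrix.mul_assoc, ← pow_two]
      rw [hBT, hB]
      simp only [Matrix.add_mul, Matrix.mul_add, Matrix.smul_mul, Matrix.mul_smul, hA2,
        Matrix.one_mul, Matrix.mul_one, show Aᵀ * symp ℝ = symp ℝ * A from hA]
    have hJB : symp ℝ * Bᵀ = B * symp ℝ := by
      have := congrArg (fun W => symp ℝ * W * symp ℝ) hBJ
      simp only [Matrix.mul_assoc, symp_mul_symp] at this
      rw [← Matrix.mul_assoc (symp ℝ) (symp ℝ), symp_mul_symp] at this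
      simpa using this
    have hg : symp (MvPolynomial Idx ℝ) * constMat B = constMat (symp ℝ * B) := by
      rw [constMat_mul, constMat_symp]
    have hjac : jacobian ((symp (MvPolynomial Idx ℝ) * constMat B) *ᵥ gradient H)
        = (constMat B)ᵀ * jacobian (hamField H) := by
      rw [hg, jacobian_constMat_mulVec, ← hBJ, constMat_mul, constMat_symp, constMat_transpose,
        Matrix.mul_assoc, jacobian_hamField]
    have hg2 : ∀ i, (((symp (MvPolynomial Idx ℝ) * constMat B) *ᵥ gradient H) i).IsHomogeneous 2 :=
      fun i => hg ▸ isHomogeneous_hamField hH _ i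
    set g := (symp (MvPolynomial Idx ℝ) * constMat B) *ᵥ gradient H
    have hgM : ∀ x, evalMat (jacobian g) x = Bᵀ * M x := by
      intro x
      rw [hjac, evalMat_mul, evalMat_transpose, evalMat_constMat]
    have hBT2 : Bᵀ ^ 2 = 1 := by rw [← transpose_pow, hB2, transpose_one]
    -- `Bᵀ` commutes with `M(x)` and is an involution. Hence `f` and `g` define the same tensor, and
    -- it remains to check for `g` the hypotheses already verified for `f`.
    have hgsq : ∀ x, evalMat (jacobian g) x ^ 2 = M x ^ 2 := by
      intro x
      rw [hgM, (hBM x).mul_pow, hBT2, Matrix.one_mul]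
    have htens : evalMat (tensor (hamField H) ε) = evalMat (tensor g ε) := by
      funext x
      rw [evalMat_tensor, evalMat_tensor, hgsq]
    rw [htens]
    refine isPoissonMapOn_kahanMap hg2 (fun x => ?_) (fun x y => ?_) ε
    · rw [hgM, transpose_mul, transpose_transpose, Matrix.mul_assoc, ← hJB, ← Matrix.mul_assoc, hM,
        neg_mul, Matrix.mul_assoc, (hBM x).eq]
    · rw [hgsq, hgM, hMsq]
      exact (hpoly _ _ _ _ (hBT ▸ (hpoly _ _ _ _ (Commute.refl _)).symm)).mul_right
        (hpoly _ _ _ _ (hMA y))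
  · rw [tensor_toCPoly, jacobian_sq_eq hA hev hchar hPDE]
    simp only [Fin.sum_univ_three, Matrix.add_mul, Matrix.smul_mul, Matrix.one_mul,
      MvPolynomial.smul_eq_C_mul, smul_matrix_eq_C_smul]
    module
  · rw [tensor, hsq]
    simp only [Matrix.add_mul, Matrix.smul_mul, Matrix.one_mul, MvPolynomial.smul_eq_C_mul,
      smul_matrix_eq_C_smul]
    module
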